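/- Let $N\ge 1$, $p>1$, and let $\Omega\subseteq\mathbb{R}^N$ be open with finite Lebesgue measure. Let $H:\mathbb{R}^N\to[0,\infty)$ be continuous and convex (not necessarily strictly convex, nor even), with $H(0)=0$ and $H(z)\ge \frac1C|z|^p$ for all $z\in\mathbb{R}^N$ and some constant $C>0$. Let $f:\mathbb{R}\to\mathbb{R}$ be continuous and even, with $f(t)\le C'(t^{p-1}+1)$ for all $t\ge 0$ and some constant $C'$, and suppose that for some $M_f\in[0,+\infty]$ $$f(t)>0\quad\text{for } 0<|t|<M_f,\qquad f(t)\le 0\quad\text{for } |t|\ge M_f .$$ Let $W^{1,p}_0$ denote the closure of $C^\infty_c$ in $W^{1,p}$. Let $u$ be a non-negative energy critical point of $J(v)=\int_\Omega \frac1p H(Dv)-F(v)\,dx$, $F(t)=\int_0^t f(s)\,ds$; that is, $u\in W^{1,p}_0(\Omega)$, $u\ge 0$ a.e. in $\Omega$, and $u$ minimises $$v\mapsto J_u(v)=\int_\Omega \tfrac1p H(Dv)-f(u)\,v\,dx\in(-\infty,+\infty]$$ among all $v\in W^{1,p}_0(\Omega)$ with $v\ge 0$ a.e. in $\Omega$.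 Let $A\subseteq\Omega$ be open and let $\underline u\in W^{1,p}(A)$ satisfy $\int_A H(D\underline u)\,dx<+\infty$ and minimise $v\mapsto\int_A H(Dv)\,dx$ over $\underline u+W^{1,p}_0(A)$. If $(\underline u-u)_+\in W^{1,p}_0(A)$, then $u\ge\underline u$ a.e. in $A$. -/

import Mathlib

open MeasureTheory Set Filter Topology
open scoped ENNReal ContDiff

noncomputable section

namespace Comparison

/-- The test functions `C_c^∞(U)`. -/
def IsTestFunction {N : ℕ} (U : Set (EuclideanSpace ℝ (Fin N)))
    (φ : EuclideanSpace ℝ (Fin N) → ℝ) : Prop :=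
  ContDiff ℝ ∞ φ ∧ HasCompactSupport φ ∧ tsupport φ ⊆ U

/-- `G` is a weak (distributional) gradient of `u` in the open set `U`. Functions on `U` are
represented by functions on the whole space, whose values off `U` play no role. -/
def HasWeakGradient {N : ℕ} (U : Set (EuclideanSpace ℝ (Fin N)))
    (u : EuclideanSpace ℝ (Fin N) → ℝ)
    (G : EuclideanSpace ℝ (Fin N) → EuclideanSpace ℝ (Fin N)) : Prop :=
  LocallyIntegrableOn u U volume ∧ LocallyIntegrableOn G U volume ∧
    ∀ φ : EuclideanSpace ℝ (Fin N) → ℝ, IsTestFunction U φ →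
      ∫ x in U, u x • gradient φ x = - ∫ x in U, φ x • G x

open Classical in
/-- The weak gradient `Du` of `u` in `U` (zero if there is none). -/
def weakGradient {N : ℕ} (U : Set (EuclideanSpace ℝ (Fin N)))
    (u : EuclideanSpace ℝ (Fin N) → ℝ) : EuclideanSpace ℝ (Fin N) → EuclideanSpace ℝ (Fin N) :=
  if h : ∃ G, HasWeakGradient U u G then h.choose else 0

/-- Weak gradients are unique up to null sets. -/
theorem HasWeakGradient.ae_eq {N : ℕ} {U : Set (EuclideanSpace ℝ (Fin N))} (hU : IsOpen U)
    {u : EuclideanSpace ℝ (Fin N) → ℝ}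
    {G G' : EuclideanSpace ℝ (Fin N) → EuclideanSpace ℝ (Fin N)}
    (hG : HasWeakGradient U u G) (hG' : HasWeakGradient U u G') :
    G =ᵐ[volume.restrict U] G' := by
  have key : ∀ᵐ x ∂volume, x ∈ U → (G - G') x = 0 := by
    refine hU.ae_eq_zero_of_integral_contDiff_smul_eq_zero (hG.2.1.sub hG'.2.1) ?_
    intro φ hφ hc hs
    have hint : ∀ {K : EuclideanSpace ℝ (Fin N) → EuclideanSpace ℝ (Fin N)},
        LocallyIntegrableOn K U volume → Integrable (fun x => φ x • K x) volume := by
      intro K hK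
      have hK' : IntegrableOn K (tsupport φ) volume := hK.integrableOn_compact_subset hs hc
      have h1 : IntegrableOn (fun x => φ x • K x) (tsupport φ) volume :=
        hK'.continuousOn_smul hφ.continuous.continuousOn hc
      refine (integrableOn_iff_integrable_of_support_subset ?_).1 h1
      intro x hx
      refine subset_tsupport φ ?_
      intro h0
      exact hx (by simp [h0])
    have hset : ∀ {K : EuclideanSpace ℝ (Fin N) → EuclideanSpace ℝ (Fin N)},
        ∫ x in U, φ x • K x = ∫ x, φ x • K x := by
      intro K
      refine setIntegral_eq_integral_of_forall_compl_eq_zero ?_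
      intro x hx
      have : φ x = 0 := image_eq_zero_of_notMem_tsupport fun h => hx (hs h)
      simp [this]
    have h1 := hG.2.2 φ ⟨hφ, hc, hs⟩
    have h2 := hG'.2.2 φ ⟨hφ, hc, hs⟩
    have h3 : ∫ x, φ x • G x = ∫ x, φ x • G' x := by
      rw [← hset, ← hset]
      exact neg_injective (h1.symm.trans h2)
    simp only [Pi.sub_apply, smul_sub]
    rw [integral_sub (hint hG.2.1) (hint hG'.2.1), h3, sub_self]
  rw [Filter.EventuallyEq, ae_restrict_iff' hU.measurableSet]
  filter_upwards [key] with x hx hxU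
  exact sub_eq_zero.1 (hx hxU)

/-- The chosen `weakGradient` is a weak gradient whenever there is one. -/
theorem HasWeakGradient.weakGradient {N : ℕ} {U : Set (EuclideanSpace ℝ (Fin N))}
    {u : EuclideanSpace ℝ (Fin N) → ℝ}
    {G : EuclideanSpace ℝ (Fin N) → EuclideanSpace ℝ (Fin N)}
    (hG : HasWeakGradient U u G) : HasWeakGradient U u (weakGradient U u) := by
  have h : ∃ G, HasWeakGradient U u G := ⟨G, hG⟩
  rw [Comparison.weakGradient, dif_pos h]
  exact h.choose_spec

/-- `u ∈ W^{1,p}(U)`. -/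
def MemW1p {N : ℕ} (p : ℝ) (U : Set (EuclideanSpace ℝ (Fin N)))
    (u : EuclideanSpace ℝ (Fin N) → ℝ) : Prop :=
  MemLp u (ENNReal.ofReal p) (volume.restrict U) ∧
    ∃ G, HasWeakGradient U u G ∧ MemLp G (ENNReal.ofReal p) (volume.restrict U)

/-- `u ∈ W^{1,p}_0(U)`: the closure of `C_c^∞(U)` in `W^{1,p}(U)`. -/
def MemW1pZero {N : ℕ} (p : ℝ) (U : Set (EuclideanSpace ℝ (Fin N)))
    (u : EuclideanSpace ℝ (Fin N) → ℝ) : Prop :=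
  MemW1p p U u ∧ ∃ φ : ℕ → EuclideanSpace ℝ (Fin N) → ℝ,
    (∀ n, IsTestFunction U (φ n)) ∧
    Tendsto (fun n => eLpNorm (fun x => u x - φ n x)
      (ENNReal.ofReal p) (volume.restrict U)) atTop (𝓝 0) ∧
    Tendsto (fun n => eLpNorm (fun x => weakGradient U u x - gradient (φ n) x)
      (ENNReal.ofReal p) (volume.restrict U)) atTop (𝓝 0)

/-- The integral over `U` of a real function as an extended real number, `∫ g₊ - ∫ g₋`. (It is
only used for functions `g` whose negative part has a finite integral.) -/
def extIntegral {N : ℕ} (U : Set (EuclideanSpace ℝ (Fin N)))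
    (g : EuclideanSpace ℝ (Fin N) → ℝ) : EReal :=
  ((∫⁻ x in U, ENNReal.ofReal (g x) : ℝ≥0∞) : EReal) -
    ((∫⁻ x in U, ENNReal.ofReal (- g x) : ℝ≥0∞) : EReal)

/-- The semi-linearised functional `J_u(v) = ∫_Ω (1/p) H(Dv) - f(u) v dx`. -/
def semilinearized {N : ℕ} (p : ℝ) (H : EuclideanSpace ℝ (Fin N) → ℝ) (f : ℝ → ℝ)
    (Ω : Set (EuclideanSpace ℝ (Fin N))) (u v : EuclideanSpace ℝ (Fin N) → ℝ) : EReal :=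
  extIntegral Ω (fun x => 1 / p * H (weakGradient Ω v x) - f (u x) * v x)

/-- `u ∈ C_J^+`: `u` is a non-negative energy critical point of
`J(v) = ∫_Ω (1/p) H(Dv) - F(v) dx`, i.e. it minimises `J_u` among the non-negative functions of
`W^{1,p}_0(Ω)`, being one of them. -/
def IsNonnegEnergyCriticalPoint {N : ℕ} (p : ℝ) (H : EuclideanSpace ℝ (Fin N) → ℝ) (f : ℝ → ℝ)
    (Ω : Set (EuclideanSpace ℝ (Fin N))) (u : EuclideanSpace ℝ (Fin N) → ℝ) : Prop :=
  MemW1pZero p Ω u ∧ (∀ᵐ x ∂volume.restrict Ω, 0 ≤ u x) ∧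
    ∀ v : EuclideanSpace ℝ (Fin N) → ℝ, MemW1pZero p Ω v →
      (∀ᵐ x ∂volume.restrict Ω, 0 ≤ v x) →
      semilinearized p H f Ω u u ≤ semilinearized p H f Ω u v

/-- The energy `∫_A H(Dv) dx ∈ [0, ∞]` of a non-negative density `H`. -/
def energy {N : ℕ} (H : EuclideanSpace ℝ (Fin N) → ℝ) (A : Set (EuclideanSpace ℝ (Fin N)))
    (v : EuclideanSpace ℝ (Fin N) → ℝ) : ℝ≥0∞ :=
  ∫⁻ x in A, ENNReal.ofReal (H (weakGradient A v x))

/-- `w ∈ W^{1,p}(A)` is a (finite-energy) minimiser of `v ↦ ∫_A H(Dv) dx` in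
`w + W^{1,p}_0(A)`. -/
def IsEnergyMinimiser {N : ℕ} (p : ℝ) (H : EuclideanSpace ℝ (Fin N) → ℝ)
    (A : Set (EuclideanSpace ℝ (Fin N))) (w : EuclideanSpace ℝ (Fin N) → ℝ) : Prop :=
  MemW1p p A w ∧ energy H A w < ⊤ ∧
    ∀ v : EuclideanSpace ℝ (Fin N) → ℝ, MemW1pZero p A (fun x => v x - w x) →
      energy H A w ≤ energy H A v

end Comparison

end

/-! Let `φ = (w - u)₊` in `A`, extended by zero. Then `u + φ` is `max u w` and `w - φ` is `min u w`
in `A`. The max and the min merely exchange the gradients of `u` and `w` on `{w > u}`, so almost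
everywhere `H (Du + Dφ) - H (Du) = H (Dw) - H (Dw - Dφ)`. Minimality of `u` against the max bounds
`∫ f(u) φ` by `1/p` times the integral of the left side. Minimality of `w` against the min makes the
integral of the right side non-positive. Hence `∫ f(u) φ ≤ 0`.

If `M ≠ 0`, truncating at `M` shows `u ≤ M` (`IsNonnegEnergyCriticalPoint.le_threshold`), so `f(u) ≥
0` by continuity and `f(u) φ = 0` almost everywhere. Thus on `{w > u}` the function `u` takes only
the values at which `f` may vanish, namely `0` and `M`; if `M = 0`, truncation already gives `u =
0`. A Sobolev function has zero gradient almost everywhere on a level set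
(`HasWeakGradient.ae_eq_zero_of_eq`), so `Du = 0` on `{w > u}`.

The energy of `min u w` then differs from that of `w` by the loss of `H (Dw)` on `{w > u}`.
Minimality of `w` forces `H (Dw) = 0` there, and the lower bound on `H` gives `Dw = 0`. So `Dφ = 0`,
and a function of the closure of the test functions with zero gradient vanishes
(`IsSobolevZero.ae_eq_zero`). No uniqueness of minimisers enters.

The Sobolev calculus is carried by `IsSobolevZero`, which names the gradient as an explicit
function; this keeps the choice behind `weakGradient` out of the computations until uniqueness
identifies the two. -/

namespace Comparison

/-! ### Gradients of smooth functions and test functions. -/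

section

variable {N : ℕ} {U V : Set (EuclideanSpace ℝ (Fin N))} {q : ℝ≥0∞}
  {φ ψ : EuclideanSpace ℝ (Fin N) → ℝ}

theorem HasGradientAt.comp_real {χ : ℝ → ℝ} {c : ℝ} {x G : EuclideanSpace ℝ (Fin N)}
    (hφ : HasGradientAt φ G x) (hχ : HasDerivAt χ c (φ x)) :
    HasGradientAt (fun y => χ (φ y)) (c • G) x := by
  rw [hasGradientAt_iff_hasFDerivAt] at *
  rw [map_smulₛₗ]
  exact hχ.comp_hasFDerivAt x hφ

theorem HasGradientAt.add_real {x G G' : EuclideanSpace ℝ (Fin N)}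
    (hφ : HasGradientAt φ G x) (hψ : HasGradientAt ψ G' x) :
    HasGradientAt (fun y => φ y + ψ y) (G + G') x := by
  rw [hasGradientAt_iff_hasFDerivAt] at *
  rw [map_add]
  exact hφ.add hψ

theorem HasGradientAt.mul_real {x G G' : EuclideanSpace ℝ (Fin N)}
    (hφ : HasGradientAt φ G x) (hψ : HasGradientAt ψ G' x) :
    HasGradientAt (fun y => φ y * ψ y) (φ x • G' + ψ x • G) x := by
  rw [hasGradientAt_iff_hasFDerivAt] at *
  rw [map_add, map_smulₛₗ, map_smulₛₗ]
  exact hφ.mul hψ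

theorem _root_.ContDiff.continuous_gradient (hφ : ContDiff ℝ ∞ φ) : Continuous (gradient φ) := by
  unfold gradient
  exact (InnerProductSpace.toDual ℝ _).symm.continuous.comp (hφ.continuous_fderiv (by simp))

theorem _root_.ContDiff.hasGradientAt_gradient (hφ : ContDiff ℝ ∞ φ)
    (x : EuclideanSpace ℝ (Fin N)) : HasGradientAt φ (gradient φ x) x :=
  (hφ.differentiable (by simp)).differentiableAt.hasGradientAt

theorem gradient_eq_zero_of_notMem_tsupport {x : EuclideanSpace ℝ (Fin N)} (hx : x ∉ tsupport φ) :
    gradient φ x = 0 := by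
  have : φ =ᶠ[𝓝 x] fun _ => 0 := notMem_tsupport_iff_eventuallyEq.1 hx
  rw [this.gradient_eq, gradient_fun_const]

namespace IsTestFunction

theorem mono (h : IsTestFunction U φ) (hUV : U ⊆ V) : IsTestFunction V φ :=
  ⟨h.1, h.2.1, h.2.2.trans hUV⟩

theorem of_support (h : IsTestFunction U φ) (hψ : ContDiff ℝ ∞ ψ)
    (hz : ∀ x, φ x = 0 → ψ x = 0) : IsTestFunction U ψ := by
  have : Function.support ψ ⊆ Function.support φ := fun x hx h0 => hx (hz x h0)
  exact ⟨hψ, h.2.1.mono this, (closure_mono this).trans h.2.2⟩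

theorem comp (h : IsTestFunction U φ) {χ : ℝ → ℝ} (hχ : ContDiff ℝ ∞ χ) (h0 : χ 0 = 0) :
    IsTestFunction U (fun x => χ (φ x)) :=
  h.of_support (hχ.comp h.1) fun x hx => by rw [hx, h0]

theorem mul_left (h : IsTestFunction U φ) (hψ : ContDiff ℝ ∞ ψ) :
    IsTestFunction U (fun x => ψ x * φ x) :=
  h.of_support (hψ.mul h.1) fun x hx => by rw [hx, mul_zero]

theorem add (h : IsTestFunction U φ) (h' : IsTestFunction U ψ) :
    IsTestFunction U (fun x => φ x + ψ x) :=
  ⟨h.1.add h'.1, h.2.1.add h'.2.1,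
    (tsupport_add φ ψ).trans (union_subset h.2.2 h'.2.2)⟩

theorem apply_eq_zero (h : IsTestFunction U φ) {x : EuclideanSpace ℝ (Fin N)} (hx : x ∉ U) :
    φ x = 0 := image_eq_zero_of_notMem_tsupport fun hx' => hx (h.2.2 hx')

theorem gradient_eq_zero (h : IsTestFunction U φ) {x : EuclideanSpace ℝ (Fin N)} (hx : x ∉ U) :
    gradient φ x = 0 := gradient_eq_zero_of_notMem_tsupport fun hx' => hx (h.2.2 hx')

theorem continuous_gradient (h : IsTestFunction U φ) : Continuous (gradient φ) :=
  h.1.continuous_gradient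

theorem hasCompactSupport_gradient (h : IsTestFunction U φ) : HasCompactSupport (gradient φ) :=
  HasCompactSupport.intro h.2.1 fun _ hx => gradient_eq_zero_of_notMem_tsupport hx

theorem memLp (h : IsTestFunction U φ) (q : ℝ≥0∞) : MemLp φ q volume :=
  h.1.continuous.memLp_of_hasCompactSupport h.2.1

theorem memLp_gradient (h : IsTestFunction U φ) (q : ℝ≥0∞) : MemLp (gradient φ) q volume :=
  h.continuous_gradient.memLp_of_hasCompactSupport h.hasCompactSupport_gradient

/-- Pairing with a fixed vector reduces this to scalar integration by parts for directional
derivatives. It is the smooth case from which weak gradients of limits are obtained. -/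
theorem integral_smul_gradient (hφ : IsTestFunction U φ) (hψ : IsTestFunction V ψ) :
    ∫ x, φ x • gradient ψ x = - ∫ x, ψ x • gradient φ x := by
  have i1 : Integrable (fun x => φ x • gradient ψ x) :=
    (hφ.1.continuous.smul hψ.continuous_gradient).integrable_of_hasCompactSupport
      (hφ.2.1.smul_right)
  have i2 : Integrable (fun x => ψ x • gradient φ x) :=
    (hψ.1.continuous.smul hφ.continuous_gradient).integrable_of_hasCompactSupport
      (hψ.2.1.smul_right)
  refine ext_inner_left ℝ fun v => ?_
  rw [inner_neg_right, ← integral_inner i1, ← integral_inner i2]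
  have e : ∀ (g : EuclideanSpace ℝ (Fin N) → ℝ) (c : ℝ) (x : EuclideanSpace ℝ (Fin N)),
      inner ℝ v (c • gradient g x) = c * fderiv ℝ g x v := by
    intro g c x
    rw [inner_smul_right, inner_gradient_right]
    simp
  simp_rw [e]
  have := integral_mul_fderiv_eq_neg_fderiv_mul_of_integrable (μ := volume) (f := φ) (g := ψ)
    (v := v) ?_ ?_ ?_ (fun x _ => (hφ.1.differentiable (by simp)).differentiableAt)
    (fun x _ => (hψ.1.differentiable (by simp)).differentiableAt)
  · rw [this]
    congr 2
    ext x
    ring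
  · refine (i2.const_inner v).congr (Eventually.of_forall fun x => ?_)
    simp only [e]
    ring
  · refine (i1.const_inner v).congr (Eventually.of_forall fun x => ?_)
    simp only [e]
  · exact (hφ.1.continuous.mul hψ.1.continuous).integrable_of_hasCompactSupport hφ.2.1.mul_right

end IsTestFunction

/-! ### The closure of the test functions, with explicit gradients. -/

/-- `(u, G)` is a limit in `L^q(U)` of pairs `(φ, ∇φ)` of test functions in `U` and their
gradients. -/
structure IsSobolevZero (q : ℝ≥0∞) (U : Set (EuclideanSpace ℝ (Fin N)))
    (u : EuclideanSpace ℝ (Fin N) → ℝ)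
    (G : EuclideanSpace ℝ (Fin N) → EuclideanSpace ℝ (Fin N)) : Prop where
  memLp : MemLp u q (volume.restrict U)
  memLp_grad : MemLp G q (volume.restrict U)
  approx : ∀ ε : ℝ≥0∞, 0 < ε → ∃ φ, IsTestFunction U φ ∧
    eLpNorm (fun x => u x - φ x) q (volume.restrict U) ≤ ε ∧
    eLpNorm (fun x => G x - gradient φ x) q (volume.restrict U) ≤ ε

variable {u v : EuclideanSpace ℝ (Fin N) → ℝ}
  {G K : EuclideanSpace ℝ (Fin N) → EuclideanSpace ℝ (Fin N)}

theorem _root_.MeasureTheory.MemLp.locallyIntegrableOn_restrict {F : Type*} [NormedAddCommGroup F]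
    {g : EuclideanSpace ℝ (Fin N) → F} (hq : 1 ≤ q) (h : MemLp g q (volume.restrict U)) :
    LocallyIntegrableOn g U volume :=
  locallyIntegrableOn_of_locallyIntegrable_restrict (h.locallyIntegrable hq)

namespace IsSobolevZero

theorem exists_seq (h : IsSobolevZero q U u G) : ∃ φ : ℕ → EuclideanSpace ℝ (Fin N) → ℝ,
    (∀ n, IsTestFunction U (φ n)) ∧
    Tendsto (fun n => eLpNorm (fun x => u x - φ n x) q (volume.restrict U)) atTop (𝓝 0) ∧
    Tendsto (fun n => eLpNorm (fun x => G x - gradient (φ n) x) q (volume.restrict U))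
      atTop (𝓝 0) := by
  -- At `n = 0` the tolerance is `⊤`, which is harmless.
  have h1 : ∀ n : ℕ, (0 : ℝ≥0∞) < ((n : ℝ≥0∞))⁻¹ := fun n => by simp
  choose φ h2 h3 h4 using fun n => h.approx _ (h1 n)
  exact ⟨φ, h2,
    tendsto_of_tendsto_of_tendsto_of_le_of_le tendsto_const_nhds ENNReal.tendsto_inv_nat_nhds_zero
      (fun _ => zero_le) h3,
    tendsto_of_tendsto_of_tendsto_of_le_of_le tendsto_const_nhds ENNReal.tendsto_inv_nat_nhds_zero
      (fun _ => zero_le) h4⟩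

theorem of_seq (hu : MemLp u q (volume.restrict U)) (hG : MemLp G q (volume.restrict U))
    {φ : ℕ → EuclideanSpace ℝ (Fin N) → ℝ} (hφ : ∀ n, IsTestFunction U (φ n))
    (h1 : Tendsto (fun n => eLpNorm (fun x => u x - φ n x) q (volume.restrict U)) atTop (𝓝 0))
    (h2 : Tendsto (fun n => eLpNorm (fun x => G x - gradient (φ n) x) q (volume.restrict U))
      atTop (𝓝 0)) : IsSobolevZero q U u G := by
  refine ⟨hu, hG, fun ε hε => ?_⟩
  obtain ⟨n, hn⟩ := ((h1.eventually (Iic_mem_nhds hε)).and (h2.eventually (Iic_mem_nhds hε))).exists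
  exact ⟨φ n, hφ n, hn.1, hn.2⟩

/-- The class is closed under limits. -/
theorem of_approx (hq : 1 ≤ q) (hu : MemLp u q (volume.restrict U))
    (hG : MemLp G q (volume.restrict U))
    (h : ∀ ε : ℝ≥0∞, 0 < ε → ∃ v K, IsSobolevZero q U v K ∧
      eLpNorm (fun x => u x - v x) q (volume.restrict U) ≤ ε ∧
      eLpNorm (fun x => G x - K x) q (volume.restrict U) ≤ ε) : IsSobolevZero q U u G := by
  refine ⟨hu, hG, fun ε hε => ?_⟩
  obtain ⟨v, K, hv, h1, h2⟩ := h (ε / 2) (ENNReal.half_pos hε.ne')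
  obtain ⟨φ, hφ, h3, h4⟩ := hv.approx (ε / 2) (ENNReal.half_pos hε.ne')
  refine ⟨φ, hφ, ?_, ?_⟩
  · have := eLpNorm_add_le (hu.1.sub hv.memLp.1)
      (hv.memLp.1.sub (hφ.memLp q).1.restrict) hq
    simp only [sub_add_sub_cancel] at this
    exact this.trans ((add_le_add h1 h3).trans (ENNReal.add_halves ε).le)
  · have := eLpNorm_add_le (hG.1.sub hv.memLp_grad.1)
      (hv.memLp_grad.1.sub (hφ.memLp_gradient q).1.restrict) hq
    simp only [sub_add_sub_cancel] at this
    exact this.trans ((add_le_add h2 h4).trans (ENNReal.add_halves ε).le)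

theorem congr (h : IsSobolevZero q U u G) (hv : u =ᵐ[volume.restrict U] v)
    (hK : G =ᵐ[volume.restrict U] K) : IsSobolevZero q U v K := by
  refine ⟨h.memLp.ae_eq hv, h.memLp_grad.ae_eq hK, fun ε hε => ?_⟩
  obtain ⟨φ, hφ, h1, h2⟩ := h.approx ε hε
  refine ⟨φ, hφ, (eLpNorm_congr_ae ?_).trans_le h1, (eLpNorm_congr_ae ?_).trans_le h2⟩
  · filter_upwards [hv] with x hx
    rw [hx]
  · filter_upwards [hK] with x hx
    rw [hx]

theorem const_smul (h : IsSobolevZero q U u G) (c : ℝ) :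
    IsSobolevZero q U (fun x => c * u x) (fun x => c • G x) := by
  obtain ⟨φ, hφ, h1, h2⟩ := h.exists_seq
  have lim : ∀ {a : ℕ → ℝ≥0∞}, Tendsto a atTop (𝓝 0) →
      Tendsto (fun n => ‖c‖ₑ * a n) atTop (𝓝 0) := fun {a} ha => by
    simpa using ENNReal.Tendsto.const_mul ha (Or.inr (enorm_ne_top (x := c)))
  refine of_seq (φ := fun n x => c * φ n x) (h.memLp.const_mul c) (h.memLp_grad.const_smul c)
    (fun n => (hφ n).mul_left contDiff_const) ?_ ?_
  · refine (lim h1).congr fun n => ?_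
    rw [← eLpNorm_const_smul]
    congr 1
    ext x
    simp [mul_sub]
  · refine (lim h2).congr fun n => ?_
    rw [← eLpNorm_const_smul]
    congr 1
    ext1 x
    have : gradient (fun x => c * φ n x) x = c • gradient (φ n) x :=
      (HasGradientAt.comp_real ((hφ n).1.hasGradientAt_gradient x)
        (by simpa using (hasDerivAt_id _).const_mul c)).gradient
    simp [smul_sub, this]

theorem add (hq : 1 ≤ q) (h : IsSobolevZero q U u G) (h' : IsSobolevZero q U v K) :
    IsSobolevZero q U (fun x => u x + v x) (fun x => G x + K x) := by
  refine ⟨h.memLp.add h'.memLp, h.memLp_grad.add h'.memLp_grad, fun ε hε => ?_⟩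
  obtain ⟨φ, hφ, h1, h2⟩ := h.approx (ε / 2) (ENNReal.half_pos hε.ne')
  obtain ⟨ψ, hψ, h3, h4⟩ := h'.approx (ε / 2) (ENNReal.half_pos hε.ne')
  refine ⟨fun x => φ x + ψ x, hφ.add hψ, ?_, ?_⟩
  · have := eLpNorm_add_le (h.memLp.1.sub (hφ.memLp q).1.restrict)
      (h'.memLp.1.sub (hψ.memLp q).1.restrict) hq
    refine le_trans (le_of_eq ?_) (this.trans ((add_le_add h1 h3).trans (ENNReal.add_halves ε).le))
    congr 1
    ext x
    simp only [Pi.add_apply, Pi.sub_apply]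
    ring
  · have := eLpNorm_add_le (h.memLp_grad.1.sub (hφ.memLp_gradient q).1.restrict)
      (h'.memLp_grad.1.sub (hψ.memLp_gradient q).1.restrict) hq
    refine le_trans (le_of_eq ?_) (this.trans ((add_le_add h2 h4).trans (ENNReal.add_halves ε).le))
    congr 1
    ext1 x
    have : gradient (fun x => φ x + ψ x) x = gradient φ x + gradient ψ x :=
      (HasGradientAt.add_real (hφ.1.hasGradientAt_gradient x)
        (hψ.1.hasGradientAt_gradient x)).gradient
    simp only [Pi.add_apply, Pi.sub_apply, this]
    abel

theorem sub (hq : 1 ≤ q) (h : IsSobolevZero q U u G) (h' : IsSobolevZero q U v K) :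
    IsSobolevZero q U (fun x => u x - v x) (fun x => G x - K x) := by
  simpa [sub_eq_add_neg] using h.add hq (h'.const_smul (-1))

/-- Extension by zero. -/
theorem indicator (hU : MeasurableSet U) (hUV : U ⊆ V) (h : IsSobolevZero q U u G) :
    IsSobolevZero q V (U.indicator u) (U.indicator G) := by
  have key : ∀ {F : Type} [NormedAddCommGroup F] (g : EuclideanSpace ℝ (Fin N) → F),
      eLpNorm (U.indicator g) q (volume.restrict V) = eLpNorm g q (volume.restrict U) := by
    intro F _ g
    rw [eLpNorm_indicator_eq_eLpNorm_restrict hU, Measure.restrict_restrict hU,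
      inter_eq_left.2 hUV]
  have meas : ∀ {F : Type} [NormedAddCommGroup F] {g : EuclideanSpace ℝ (Fin N) → F},
      MemLp g q (volume.restrict U) → MemLp (U.indicator g) q (volume.restrict V) := by
    intro F _ g hg
    rwa [memLp_indicator_iff_restrict hU, Measure.restrict_restrict hU, inter_eq_left.2 hUV]
  refine ⟨meas h.memLp, meas h.memLp_grad, fun ε hε => ?_⟩
  obtain ⟨φ, hφ, h1, h2⟩ := h.approx ε hε
  refine ⟨φ, hφ.mono hUV, ?_, ?_⟩
  · rw [← key] at h1
    convert h1 using 2
    ext x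
    by_cases hx : x ∈ U
    · simp [hx]
    · simp [hx, hφ.apply_eq_zero hx]
  · rw [← key] at h2
    convert h2 using 2
    ext1 x
    by_cases hx : x ∈ U
    · simp [hx]
    · simp [hx, hφ.gradient_eq_zero hx]


/-- Hölder's inequality with the conjugate exponent. Since `b` lies in every `L^r`, the case `q = 1`
needs no separate treatment. -/
theorem _root_.MeasureTheory.tendsto_integral_zero_of_eLpNorm {α F₁ F₂ F₃ : Type*}
    [MeasurableSpace α] {μ : Measure α} [NormedAddCommGroup F₁] [NormedAddCommGroup F₂]
    [NormedAddCommGroup F₃] [NormedSpace ℝ F₃] (hq : 1 ≤ q) {a : ℕ → α → F₁} {b : α → F₂}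
    {c : ℕ → α → F₃} (ha : ∀ n, AEStronglyMeasurable (a n) μ) (hb : ∀ r, MemLp b r μ)
    (hc : ∀ n x, ‖c n x‖ₑ ≤ ‖a n x‖ₑ * ‖b x‖ₑ)
    (h : Tendsto (fun n => eLpNorm (a n) q μ) atTop (𝓝 0)) :
    Tendsto (fun n => ∫ x, c n x ∂μ) atTop (𝓝 0) := by
  have : ENNReal.HolderConjugate q (ENNReal.conjExponent q) :=
    ENNReal.HolderConjugate.conjExponent hq
  have h1 : Tendsto (fun n => eLpNorm (a n) q μ * eLpNorm b (ENNReal.conjExponent q) μ)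
      atTop (𝓝 0) := by
    simpa using ENNReal.Tendsto.mul_const h (Or.inr (hb _).2.ne)
  rw [tendsto_zero_iff_enorm_tendsto_zero]
  refine tendsto_of_tendsto_of_tendsto_of_le_of_le tendsto_const_nhds h1 (fun _ => zero_le)
    fun n => ?_
  calc ‖∫ x, c n x ∂μ‖ₑ ≤ ∫⁻ x, ‖c n x‖ₑ ∂μ := enorm_integral_le_lintegral_enorm _
    _ ≤ ∫⁻ x, ‖a n x‖ₑ * ‖b x‖ₑ ∂μ := lintegral_mono (hc n)
    _ = eLpNorm ((fun x => ‖a n x‖) • fun x => ‖b x‖) 1 μ := by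
      rw [eLpNorm_one_eq_lintegral_enorm]
      refine lintegral_congr fun x => ?_
      simp [enorm_mul]
    _ ≤ eLpNorm (fun x => ‖a n x‖) q μ * eLpNorm (fun x => ‖b x‖) (ENNReal.conjExponent q) μ :=
      eLpNorm_smul_le_mul_eLpNorm (hb 1).norm.1 (ha n).norm
    _ = _ := by rw [eLpNorm_norm, eLpNorm_norm]

/-- Both sides of the integration by parts identity are continuous under `L^q` convergence, because
a test function and its gradient lie in every `L^r`. -/
theorem hasWeakGradient (hq : 1 ≤ q) (h : IsSobolevZero q U u G) : HasWeakGradient U u G := by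
  refine ⟨h.memLp.locallyIntegrableOn_restrict hq, h.memLp_grad.locallyIntegrableOn_restrict hq,
    fun ψ hψ => ?_⟩
  obtain ⟨φ, hφ, h1, h2⟩ := h.exists_seq
  have : ENNReal.HolderConjugate q (ENNReal.conjExponent q) :=
    ENNReal.HolderConjugate.conjExponent hq
  have i1 : ∀ {g : EuclideanSpace ℝ (Fin N) → ℝ}, MemLp g q (volume.restrict U) →
      Integrable (fun x => g x • gradient ψ x) (volume.restrict U) := fun {g} hg =>
    memLp_one_iff_integrable.1 (((hψ.memLp_gradient (ENNReal.conjExponent q)).restrict U).smul hg)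
  have i2 : ∀ {g : EuclideanSpace ℝ (Fin N) → EuclideanSpace ℝ (Fin N)},
      MemLp g q (volume.restrict U) →
      Integrable (fun x => ψ x • g x) (volume.restrict U) := fun {g} hg =>
    memLp_one_iff_integrable.1 (hg.smul ((hψ.memLp (ENNReal.conjExponent q)).restrict U))
  have t1 := tendsto_integral_zero_of_eLpNorm hq (c := fun n x => (u x - φ n x) • gradient ψ x)
    (fun n => h.memLp.1.sub ((hφ n).memLp q).1.restrict)
    (fun r => (hψ.memLp_gradient r).restrict U) (fun n x => (enorm_smul _ _).le) h1
  have t2 := tendsto_integral_zero_of_eLpNorm hq (c := fun n x => ψ x • (G x - gradient (φ n) x))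
    (fun n => h.memLp_grad.1.sub ((hφ n).memLp_gradient q).1.restrict)
    (fun r => (hψ.memLp r).restrict U) (fun n x => by rw [enorm_smul, mul_comm]; rfl) h2
  have t3 := t1.add t2
  rw [add_zero] at t3
  refine eq_neg_of_add_eq_zero_left (tendsto_nhds_unique (tendsto_const_nhds.congr fun n => ?_) t3)
  have e : ∫ x in U, φ n x • gradient ψ x = - ∫ x in U, ψ x • gradient (φ n) x := by
    rw [setIntegral_eq_integral_of_forall_compl_eq_zero,
      setIntegral_eq_integral_of_forall_compl_eq_zero, (hφ n).integral_smul_gradient hψ]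
    · intro x hx
      rw [hψ.apply_eq_zero hx, zero_smul]
    · intro x hx
      rw [(hφ n).apply_eq_zero hx, zero_smul]
  simp_rw [sub_smul, smul_sub]
  rw [integral_sub (i1 h.memLp) (i1 (((hφ n).memLp q).restrict U)),
    integral_sub (i2 h.memLp_grad) (i2 (((hφ n).memLp_gradient q).restrict U)), e]
  abel

theorem memW1pZero {p : ℝ} (hp : 1 ≤ p) (hU : IsOpen U)
    (h : IsSobolevZero (ENNReal.ofReal p) U u G) : MemW1pZero p U u := by
  have hG := h.hasWeakGradient (ENNReal.one_le_ofReal.2 hp)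
  obtain ⟨φ, hφ, h1, h2⟩ := h.exists_seq
  refine ⟨⟨h.memLp, G, hG, h.memLp_grad⟩, φ, hφ, h1, h2.congr fun n => eLpNorm_congr_ae ?_⟩
  filter_upwards [hG.ae_eq hU hG.weakGradient] with x hx
  rw [hx]

theorem weakGradient_ae_eq {p : ℝ} (hp : 1 ≤ p) (hU : IsOpen U)
    (h : IsSobolevZero (ENNReal.ofReal p) U u G) :
    weakGradient U u =ᵐ[volume.restrict U] G :=
  have hG := h.hasWeakGradient (ENNReal.one_le_ofReal.2 hp)
  hG.weakGradient.ae_eq hU hG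

end IsSobolevZero

/-! ### Translation from the Sobolev classes of the statement, and algebra of weak gradients. -/

theorem MemW1p.hasWeakGradient {p : ℝ} (h : MemW1p p U u) :
    HasWeakGradient U u (weakGradient U u) := by
  obtain ⟨-, G, hG, -⟩ := h
  exact hG.weakGradient

theorem MemW1p.memLp_weakGradient {p : ℝ} (hU : IsOpen U) (h : MemW1p p U u) :
    MemLp (weakGradient U u) (ENNReal.ofReal p) (volume.restrict U) := by
  obtain ⟨-, G, hG, hL⟩ := h
  exact hL.ae_eq (hG.ae_eq hU hG.weakGradient)

theorem MemW1pZero.isSobolevZero {p : ℝ} (hU : IsOpen U) (h : MemW1pZero p U u) :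
    IsSobolevZero (ENNReal.ofReal p) U u (weakGradient U u) := by
  obtain ⟨h1, φ, hφ, h2, h3⟩ := h
  exact .of_seq h1.1 (h1.memLp_weakGradient hU) hφ h2 h3

theorem integrable_smul_of_tsupport_subset {F : Type*} [NormedAddCommGroup F] [NormedSpace ℝ F]
    {K : EuclideanSpace ℝ (Fin N) → F} (hK : LocallyIntegrableOn K U volume)
    (hφ : Continuous φ) (hc : HasCompactSupport φ) (hs : tsupport φ ⊆ U) :
    Integrable (fun x => φ x • K x) volume := by
  refine (integrableOn_iff_integrable_of_support_subset fun x hx => subset_tsupport φ ?_).1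
    ((hK.integrableOn_compact_subset hs hc).continuousOn_smul hφ.continuousOn hc)
  intro h0
  exact hx (by simp [h0])

theorem integrable_smul_of_tsupport_subset' {F : Type*} [NormedAddCommGroup F] [NormedSpace ℝ F]
    {K : EuclideanSpace ℝ (Fin N) → F} (hu : LocallyIntegrableOn u U volume)
    (hφ : Continuous K) (hc : HasCompactSupport K) (hs : tsupport K ⊆ U) :
    Integrable (fun x => u x • K x) volume := by
  refine (integrableOn_iff_integrable_of_support_subset fun x hx => subset_tsupport K ?_).1
    ((hu.integrableOn_compact_subset hs hc).smul_continuousOn hφ.continuousOn hc)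
  intro h0
  exact hx (by simp [h0])

theorem IsTestFunction.integrable_smul (h : IsTestFunction U ψ) {F : Type*} [NormedAddCommGroup F]
    [NormedSpace ℝ F] {K : EuclideanSpace ℝ (Fin N) → F} (hK : LocallyIntegrableOn K U volume) :
    Integrable (fun x => ψ x • K x) volume :=
  integrable_smul_of_tsupport_subset hK h.1.continuous h.2.1 h.2.2

theorem tsupport_gradient_subset : tsupport (gradient φ) ⊆ tsupport φ :=
  closure_minimal (fun _ hx => by_contra fun h => hx (gradient_eq_zero_of_notMem_tsupport h))
    (isClosed_tsupport φ)

theorem IsTestFunction.integrable_smul_gradient (h : IsTestFunction U ψ)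
    (hu : LocallyIntegrableOn u U volume) :
    Integrable (fun x => u x • gradient ψ x) volume :=
  integrable_smul_of_tsupport_subset' hu h.continuous_gradient h.hasCompactSupport_gradient
    (tsupport_gradient_subset.trans h.2.2)

theorem HasWeakGradient.sub (hu : HasWeakGradient U u G)
    (hv : HasWeakGradient U v K) :
    HasWeakGradient U (fun x => u x - v x) (fun x => G x - K x) := by
  refine ⟨hu.1.sub hv.1, hu.2.1.sub hv.2.1, fun ψ hψ => ?_⟩
  simp_rw [sub_smul, smul_sub]
  rw [integral_sub (hψ.integrable_smul_gradient hu.1).restrict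
    (hψ.integrable_smul_gradient hv.1).restrict, integral_sub (hψ.integrable_smul hu.2.1).restrict
    (hψ.integrable_smul hv.2.1).restrict, hu.2.2 ψ hψ, hv.2.2 ψ hψ]
  abel

/-- The gradient of a test function has integral zero, by parts against the constant `1`. This
reduces an arbitrary level set to the zero set. -/
theorem hasWeakGradient_const (c : ℝ) : HasWeakGradient U (fun _ => c) (fun _ => 0) := by
  refine ⟨(continuous_const.locallyIntegrable).locallyIntegrableOn _,
    (continuous_const.locallyIntegrable).locallyIntegrableOn _, fun ψ hψ => ?_⟩
  rw [setIntegral_eq_integral_of_forall_compl_eq_zero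
    fun x hx => by rw [hψ.gradient_eq_zero hx, smul_zero]]
  simp only [smul_zero, integral_zero, neg_zero, integral_smul]
  have hint : Integrable (gradient ψ) := memLp_one_iff_integrable.1 (hψ.memLp_gradient 1)
  have : ∫ x, gradient ψ x = 0 := by
    refine ext_inner_left ℝ fun v => ?_
    rw [← integral_inner hint, inner_zero_right]
    have := integral_mul_fderiv_eq_neg_fderiv_mul_of_integrable (μ := volume) (f := fun _ => (1 : ℝ))
      (g := ψ) (v := v) (by simp) ?_ (by simpa using memLp_one_iff_integrable.1 (hψ.memLp 1))
      (fun _ _ => differentiableAt_const _)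
      (fun x _ => (hψ.1.differentiable (by simp)).differentiableAt)
    · simpa [inner_gradient_right] using this
    · simpa [inner_gradient_right] using hint.const_inner (𝕜 := ℝ) v
  rw [this, smul_zero]

/-- An integrable function on the whole space with weak gradient zero vanishes. -/
theorem HasWeakGradient.ae_eq_zero (hN : 1 ≤ N) (hu : Integrable u)
    (h : HasWeakGradient univ u (fun _ => 0)) : u =ᵐ[volume] 0 := by
  obtain ⟨e, he⟩ : ∃ e : EuclideanSpace ℝ (Fin N), e ≠ 0 :=
    ⟨EuclideanSpace.single ⟨0, hN⟩ 1, by simp⟩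
  have key : ∀ ψ, IsTestFunction univ ψ → ∫ x, ψ x • u x = 0 := by
    intro ψ hψ
    let T : ℝ → EuclideanSpace ℝ (Fin N) → ℝ := fun t x => ψ (x - t • e)
    obtain ⟨C, hC⟩ := hψ.1.continuous.bounded_above_of_compact_support hψ.2.1
    obtain ⟨C', hC'⟩ :=
      hψ.continuous_gradient.bounded_above_of_compact_support hψ.hasCompactSupport_gradient
    have hTcd : ∀ t, ContDiff ℝ ∞ (T t) := fun t => hψ.1.comp (contDiff_id.sub contDiff_const)
    have hT : ∀ t, IsTestFunction univ (T t) := fun t =>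
      ⟨hTcd t, hψ.2.1.comp_homeomorph (Homeomorph.subRight (t • e)), subset_univ _⟩
    have hTg : ∀ t x, gradient (T t) x = gradient ψ (x - t • e) := by
      intro t x
      refine HasGradientAt.gradient ?_
      have := hψ.1.hasGradientAt_gradient (x - t • e)
      rw [hasGradientAt_iff_hasFDerivAt] at *
      have h2 := this.comp x ((hasFDerivAt_id x).sub_const (t • e))
      rw [ContinuousLinearMap.comp_id] at h2
      exact h2
    have hderiv : ∀ t, HasDerivAt (fun t => ∫ x, T t x • u x) 0 t := by
      intro t
      have h0 : ∫ x, inner ℝ (-e) (gradient ψ (x - t • e)) • u x = 0 := by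
        have h1 := h.2.2 (T t) (hT t)
        simp only [smul_zero, integral_zero, neg_zero, Measure.restrict_univ] at h1
        have h2 := integral_inner (𝕜 := ℝ) ((hT t).integrable_smul_gradient
          (hu.locallyIntegrable.locallyIntegrableOn univ)) (-e)
        rw [h1, inner_zero_right] at h2
        rw [← h2]
        congr 1
        ext x
        rw [inner_smul_right, hTg, smul_eq_mul, mul_comm]
      have := hasDerivAt_integral_of_dominated_loc_of_deriv_le (μ := volume)
        (F := fun t x => T t x • u x)
        (F' := fun t x => inner ℝ (-e) (gradient ψ (x - t • e)) • u x)
        (x₀ := t) (s := univ) (bound := fun x => ‖e‖ * C' * ‖u x‖) univ_mem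
        (Eventually.of_forall fun t => (hTcd t).continuous.aestronglyMeasurable.smul hu.1)
        ((hT t).integrable_smul (hu.locallyIntegrable.locallyIntegrableOn univ)) ?_
        (Eventually.of_forall fun x s _ => ?_) (hu.norm.const_mul _)
        (Eventually.of_forall fun x s _ => ?_)
      · rw [← h0]
        exact this.2
      · have hc : Continuous fun x => inner ℝ (-e) (gradient ψ (x - t • e)) :=
          continuous_const.inner
            (hψ.continuous_gradient.comp (continuous_id.sub continuous_const))
        exact hc.aestronglyMeasurable.smul hu.1
      · rw [norm_smul]
        gcongr
        refine (norm_inner_le_norm _ _).trans ?_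
        rw [norm_neg]
        gcongr
        exact hC' _
      · refine HasDerivAt.smul_const ?_ _
        have h1 := (hψ.1.hasGradientAt_gradient (x - s • e))
        rw [hasGradientAt_iff_hasFDerivAt] at h1
        have h2 : HasDerivAt (fun s : ℝ => x - s • e) (-e) s := by
          simpa using ((hasDerivAt_id s).smul_const e).const_sub x
        have h3 := h1.comp_hasDerivAt s h2
        rwa [InnerProductSpace.toDual_apply_apply, real_inner_comm] at h3
    have hlim : Tendsto (fun t : ℝ => ∫ x, T t x • u x) atTop (𝓝 0) := by
      rw [← integral_zero (EuclideanSpace ℝ (Fin N)) ℝ (μ := volume)]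
      refine tendsto_integral_filter_of_dominated_convergence (fun x => C * ‖u x‖)
        (Eventually.of_forall fun t => (hTcd t).continuous.aestronglyMeasurable.smul hu.1)
        (Eventually.of_forall fun t => Eventually.of_forall fun x => ?_) (hu.norm.const_mul _)
        (Eventually.of_forall fun x => ?_)
      · rw [norm_smul]
        gcongr
        exact hC _
      · have h1 : Tendsto (fun t : ℝ => x - t • e) atTop (cocompact _) := by
          rw [← Metric.cobounded_eq_cocompact, ← tendsto_norm_atTop_iff_cobounded]
          refine tendsto_atTop_mono (f := fun t => t * ‖e‖ - ‖x‖) (fun t => ?_) ?_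
          · have h2 := norm_sub_norm_le (t • e) x
            rw [norm_smul, norm_sub_rev] at h2
            refine le_trans ?_ h2
            gcongr
            exact Real.le_norm_self t
          · exact tendsto_atTop_add_const_right _ _
              (tendsto_id.atTop_mul_const (norm_pos_iff.2 he))
        simpa using (hψ.2.1.is_zero_at_infty.comp h1).smul_const (u x)
    have hconst : ∀ t, ∫ x, T t x • u x = ∫ x, T 0 x • u x := fun t =>
      is_const_of_deriv_eq_zero (fun s => (hderiv s).differentiableAt)
        (fun s => (hderiv s).deriv) t 0
    have := tendsto_nhds_unique (tendsto_const_nhds.congr fun t => (hconst t).symm) hlim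
    simpa [T] using this
  exact ae_eq_zero_of_integral_contDiff_smul_eq_zero hu.locallyIntegrable
    fun g hg hc => key g ⟨hg, hc, subset_univ _⟩

end

/-! ### Chain rules in the closure of the test functions. -/

section

variable {N : ℕ} {U V : Set (EuclideanSpace ℝ (Fin N))} {q : ℝ≥0∞}
  {φ ψ : EuclideanSpace ℝ (Fin N) → ℝ}
  {u v : EuclideanSpace ℝ (Fin N) → ℝ}
  {G K : EuclideanSpace ℝ (Fin N) → EuclideanSpace ℝ (Fin N)}

theorem _root_.MeasureTheory.tendsto_eLpNorm_zero_of_dominated {α F : Type*} [MeasurableSpace α]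
    {μ : Measure α} [NormedAddCommGroup F] (hq0 : q ≠ 0) (hq : q ≠ ⊤) {g : α → ℝ}
    (hg : MemLp g q μ) {a : ℕ → α → F} (ha : ∀ n, AEStronglyMeasurable (a n) μ)
    (hag : ∀ n, ∀ᵐ x ∂μ, ‖a n x‖ ≤ g x) (hlim : ∀ᵐ x ∂μ, Tendsto (fun n => a n x) atTop (𝓝 0)) :
    Tendsto (fun n => eLpNorm (a n) q μ) atTop (𝓝 0) := by
  have hq' := ENNReal.toReal_pos hq0 hq
  have h1 : Tendsto (fun n => ∫⁻ x, ‖a n x‖ₑ ^ q.toReal ∂μ) atTop (𝓝 (∫⁻ _, 0 ∂μ)) := by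
    refine tendsto_lintegral_of_dominated_convergence' (fun x => ‖g x‖ₑ ^ q.toReal)
      (fun n => (ha n).enorm.pow_const _) (fun n => ?_)
      (lintegral_rpow_enorm_lt_top_of_eLpNorm_lt_top hq0 hq hg.2).ne ?_
    · filter_upwards [hag n] with x hx
      gcongr
      rw [enorm_le_iff_norm_le]
      exact hx.trans (Real.le_norm_self _)
    · filter_upwards [hlim] with x hx
      have := (tendsto_zero_iff_enorm_tendsto_zero.1 hx).ennrpow_const q.toReal
      rwa [ENNReal.zero_rpow_of_pos hq'] at this
  simp_rw [eLpNorm_eq_lintegral_rpow_enorm_toReal hq0 hq]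
  have := h1.ennrpow_const (1 / q.toReal)
  rwa [lintegral_zero, ENNReal.zero_rpow_of_pos (by positivity)] at this

theorem norm_sub_le_of_deriv_le {χ : ℝ → ℝ} {L : ℝ} (hχ : ContDiff ℝ ∞ χ)
    (hL : ∀ t, |deriv χ t| ≤ L) (s t : ℝ) : ‖χ s - χ t‖ ≤ L * ‖s - t‖ :=
  convex_univ.norm_image_sub_le_of_norm_deriv_le
    (fun _ _ => (hχ.differentiable (by simp)).differentiableAt) (fun _ _ => hL _)
    (mem_univ t) (mem_univ s)

namespace IsSobolevZero

/-- The chain rule for smooth Lipschitz functions. -/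
theorem comp (hq : 1 ≤ q) (hq' : q ≠ ⊤) (h : IsSobolevZero q U u G) {χ : ℝ → ℝ} {L : ℝ}
    (hχ : ContDiff ℝ ∞ χ) (h0 : χ 0 = 0) (hL : ∀ t, |deriv χ t| ≤ L) :
    IsSobolevZero q U (fun x => χ (u x)) (fun x => deriv χ (u x) • G x) := by
  have hq0 : q ≠ 0 := (zero_lt_one.trans_le hq).ne'
  have hdc : Continuous (deriv χ) := hχ.continuous_deriv (by simp)
  have hlip := norm_sub_le_of_deriv_le hχ hL
  obtain ⟨φ₀, hφ₀, h1₀, h2₀⟩ := h.exists_seq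
  -- Pass to a subsequence converging almost everywhere: `deriv χ` is only continuous and bounded,
  -- so `deriv χ (φₙ) • G` is handled by dominated convergence.
  have hconv : TendstoInMeasure (volume.restrict U) φ₀ atTop u := by
    refine tendstoInMeasure_of_tendsto_eLpNorm hq0 (fun n => ((hφ₀ n).memLp q).1.restrict)
      h.memLp.1 (h1₀.congr fun n => ?_)
    rw [← eLpNorm_neg]
    congr 1
    ext x
    simp
  obtain ⟨ns, hns, hae⟩ := hconv.exists_seq_tendsto_ae
  have h1 := h1₀.comp hns.tendsto_atTop
  have h2 := h2₀.comp hns.tendsto_atTop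
  have hφ := fun n => hφ₀ (ns n)
  have hmu : AEStronglyMeasurable (fun x => deriv χ (u x) • G x) (volume.restrict U) :=
    (hdc.comp_aestronglyMeasurable h.memLp.1).smul h.memLp_grad.1
  refine of_seq (φ := fun n x => χ (φ₀ (ns n) x)) ?_ ?_ (fun n => (hφ n).comp hχ h0) ?_ ?_
  · refine h.memLp.of_le_mul (c := L) (hχ.continuous.comp_aestronglyMeasurable h.memLp.1)
      (Eventually.of_forall fun x => ?_)
    simpa [h0] using hlip (u x) 0
  · refine h.memLp_grad.of_le_mul (c := L) hmu (Eventually.of_forall fun x => ?_)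
    rw [norm_smul]
    gcongr
    exact hL _
  · refine tendsto_of_tendsto_of_tendsto_of_le_of_le tendsto_const_nhds
      (h := fun n => ENNReal.ofReal L *
        eLpNorm (fun x => u x - φ₀ (ns n) x) q (volume.restrict U)) ?_ (fun _ => zero_le) fun n =>
        eLpNorm_le_mul_eLpNorm_of_ae_le_mul (Eventually.of_forall fun x => hlip _ _) q
    simpa using ENNReal.Tendsto.const_mul h1 (Or.inr ENNReal.ofReal_ne_top)
  -- Split the error as `(χ'(u) - χ'(φₙ)) G + χ'(φₙ) (G - ∇φₙ)`: dominated convergence for the first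
  -- term, the Lipschitz bound for the second.
  · have t1 : Tendsto (fun n => eLpNorm (fun x => (deriv χ (u x) - deriv χ (φ₀ (ns n) x)) • G x) q
        (volume.restrict U)) atTop (𝓝 0) := by
      refine tendsto_eLpNorm_zero_of_dominated hq0 hq' (h.memLp_grad.norm.const_mul (2 * L))
        (fun n => ?_) (fun n => Eventually.of_forall fun x => ?_) ?_
      · exact ((hdc.comp_aestronglyMeasurable h.memLp.1).sub
          (hdc.comp_aestronglyMeasurable ((hφ n).memLp q).1.restrict)).smul h.memLp_grad.1
      · rw [norm_smul]
        gcongr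
        refine (norm_sub_le _ _).trans ?_
        have := hL (u x)
        have := hL (φ₀ (ns n) x)
        simp only [Real.norm_eq_abs]
        linarith
      · filter_upwards [hae] with x hx
        have := ((hdc.tendsto _).comp hx).const_sub (deriv χ (u x))
        simpa using this.smul_const (G x)
    have t2 : Tendsto (fun n => eLpNorm (fun x => deriv χ (φ₀ (ns n) x) •
        (G x - gradient (φ₀ (ns n)) x)) q (volume.restrict U)) atTop (𝓝 0) := by
      refine tendsto_of_tendsto_of_tendsto_of_le_of_le tendsto_const_nhds
        (h := fun n => ENNReal.ofReal L *
          eLpNorm (fun x => G x - gradient (φ₀ (ns n)) x) q (volume.restrict U)) ?_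
          (fun _ => zero_le) fun n =>
          eLpNorm_le_mul_eLpNorm_of_ae_le_mul (Eventually.of_forall fun x => ?_) q
      · simpa using ENNReal.Tendsto.const_mul h2 (Or.inr ENNReal.ofReal_ne_top)
      · rw [norm_smul]
        gcongr
        exact hL _
    have t3 := t1.add t2
    rw [add_zero] at t3
    refine tendsto_of_tendsto_of_tendsto_of_le_of_le tendsto_const_nhds t3 (fun _ => zero_le)
      fun n => ?_
    refine le_trans (le_of_eq ?_) (eLpNorm_add_le ?_ ?_ hq)
    · congr 1
      ext1 x
      have : gradient (fun x => χ (φ₀ (ns n) x)) x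
          = deriv χ (φ₀ (ns n) x) • gradient (φ₀ (ns n)) x :=
        (HasGradientAt.comp_real ((hφ n).1.hasGradientAt_gradient x)
          ((hχ.differentiable (by simp)).differentiableAt.hasDerivAt)).gradient
      simp only [this, Pi.add_apply, sub_smul, smul_sub]
      abel
    · exact ((hdc.comp_aestronglyMeasurable h.memLp.1).sub
        (hdc.comp_aestronglyMeasurable ((hφ n).memLp q).1.restrict)).smul h.memLp_grad.1
    · exact (hdc.comp_aestronglyMeasurable ((hφ n).memLp q).1.restrict).smul
        (h.memLp_grad.1.sub ((hφ n).memLp_gradient q).1.restrict)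

/-- The chain rule for pointwise limits of smooth Lipschitz functions and their derivatives. -/
theorem comp_of_tendsto (hq : 1 ≤ q) (hq' : q ≠ ⊤) (h : IsSobolevZero q U u G)
    {χ : ℕ → ℝ → ℝ} {g d : ℝ → ℝ}
    (hχ : ∀ n, ContDiff ℝ ∞ (χ n)) (h0 : ∀ n, χ n 0 = 0) (hL : ∀ n t, |deriv (χ n) t| ≤ 1)
    (hg : ∀ t, Tendsto (fun n => χ n t) atTop (𝓝 (g t)))
    (hd : ∀ t, Tendsto (fun n => deriv (χ n) t) atTop (𝓝 (d t))) :
    IsSobolevZero q U (fun x => g (u x)) (fun x => d (u x) • G x) := by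
  have hq0 : q ≠ 0 := (zero_lt_one.trans_le hq).ne'
  have hc := fun n => h.comp hq hq' (hχ n) (h0 n) (hL n)
  have hm1 : AEStronglyMeasurable (fun x => g (u x)) (volume.restrict U) :=
    aestronglyMeasurable_of_tendsto_ae _ (fun n => (hc n).memLp.1)
      (Eventually.of_forall fun x => hg (u x))
  have hm2 : AEStronglyMeasurable (fun x => d (u x) • G x) (volume.restrict U) :=
    aestronglyMeasurable_of_tendsto_ae _ (fun n => (hc n).memLp_grad.1)
      (Eventually.of_forall fun x => (hd (u x)).smul_const (G x))
  have b1 : ∀ n t, ‖χ n t‖ ≤ ‖t‖ := fun n t => by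
    simpa [h0] using norm_sub_le_of_deriv_le (hχ n) (hL n) t 0
  have b2 : ∀ t, ‖g t‖ ≤ ‖t‖ := fun t =>
    le_of_tendsto (hg t).norm (Eventually.of_forall fun n => b1 n t)
  have b3 : ∀ t, ‖d t‖ ≤ 1 := fun t =>
    le_of_tendsto (hd t).norm (Eventually.of_forall fun n => hL n t)
  have m1 : MemLp (fun x => g (u x)) q (volume.restrict U) :=
    h.memLp.mono hm1 (Eventually.of_forall fun x => b2 _)
  have m2 : MemLp (fun x => d (u x) • G x) q (volume.restrict U) := by
    refine h.memLp_grad.mono hm2 (Eventually.of_forall fun x => ?_)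
    rw [norm_smul]
    exact mul_le_of_le_one_left (norm_nonneg _) (b3 _)
  have t1 : Tendsto (fun n => eLpNorm (fun x => g (u x) - χ n (u x)) q (volume.restrict U))
      atTop (𝓝 0) := by
    refine tendsto_eLpNorm_zero_of_dominated hq0 hq' (h.memLp.norm.const_mul 2)
      (fun n => hm1.sub (hc n).memLp.1) (fun n => Eventually.of_forall fun x => ?_)
      (Eventually.of_forall fun x => ?_)
    · refine (norm_sub_le _ _).trans ?_
      have := b1 n (u x)
      have := b2 (u x)
      linarith
    · simpa using (hg (u x)).const_sub (g (u x))
  have t2 : Tendsto (fun n => eLpNorm (fun x => d (u x) • G x - deriv (χ n) (u x) • G x) q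
      (volume.restrict U)) atTop (𝓝 0) := by
    refine tendsto_eLpNorm_zero_of_dominated hq0 hq' (h.memLp_grad.norm.const_mul 2)
      (fun n => hm2.sub (hc n).memLp_grad.1) (fun n => Eventually.of_forall fun x => ?_)
      (Eventually.of_forall fun x => ?_)
    · rw [← sub_smul, norm_smul]
      gcongr
      refine (norm_sub_le _ _).trans ?_
      have := hL n (u x)
      have := b3 (u x)
      simp only [Real.norm_eq_abs] at *
      linarith
    · simpa using ((hd (u x)).smul_const (G x)).const_sub (d (u x) • G x)
  refine of_approx hq m1 m2 fun ε hε => ?_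
  obtain ⟨n, hn⟩ := ((t1.eventually (Iic_mem_nhds hε)).and (t2.eventually (Iic_mem_nhds hε))).exists
  exact ⟨_, _, hc n, hn.1, hn.2⟩

/-- Smooth `|t - m|` as `√((t - m)² + ε²)`, whose derivative is bounded by `1`. Subtracting `|m|`
makes the outer function vanish at `0`, as membership in the closure demands; at `t = m` the
convention `0 / 0 = 0` agrees with the limit of the derivatives. -/
theorem abs_sub (hq : 1 ≤ q) (hq' : q ≠ ⊤) (h : IsSobolevZero q U u G) (m : ℝ) :
    IsSobolevZero q U (fun x => |u x - m| - |m|) (fun x => ((u x - m) / |u x - m|) • G x) := by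
  have hpos : ∀ (n : ℕ) (t : ℝ), 0 < (t - m) ^ 2 + (1 / ((n : ℝ) + 1)) ^ 2 := fun n t => by
    positivity
  have hsm : ∀ n : ℕ, ContDiff ℝ ∞ fun t : ℝ => √((t - m) ^ 2 + (1 / ((n : ℝ) + 1)) ^ 2) :=
    fun n => ContDiff.sqrt (by fun_prop) fun t => (hpos n t).ne'
  have hderiv : ∀ (n : ℕ) (t : ℝ), HasDerivAt (fun t : ℝ => √((t - m) ^ 2 +
      (1 / ((n : ℝ) + 1)) ^ 2) - √((0 - m) ^ 2 + (1 / ((n : ℝ) + 1)) ^ 2))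
      ((t - m) / √((t - m) ^ 2 + (1 / ((n : ℝ) + 1)) ^ 2)) t := by
    intro n t
    have h1 : HasDerivAt (fun t : ℝ => (t - m) ^ 2 + (1 / ((n : ℝ) + 1)) ^ 2) (2 * (t - m)) t := by
      simpa using (((hasDerivAt_id t).sub_const m).pow 2).add_const ((1 / ((n : ℝ) + 1)) ^ 2)
    have h2 := (h1.sqrt (hpos n t).ne').sub_const
      (√((0 - m) ^ 2 + (1 / ((n : ℝ) + 1)) ^ 2))
    rwa [mul_div_mul_left _ _ two_ne_zero] at h2
  have hlim : ∀ t : ℝ, Tendsto (fun n : ℕ => √((t - m) ^ 2 + (1 / ((n : ℝ) + 1)) ^ 2)) atTop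
      (𝓝 |t - m|) := by
    intro t
    have h1 := ((tendsto_one_div_add_atTop_nhds_zero_nat (𝕜 := ℝ)).pow 2).const_add ((t - m) ^ 2)
    simpa [Real.sqrt_sq_eq_abs] using h1.sqrt
  refine h.comp_of_tendsto hq hq' (g := fun t => |t - m| - |m|) (d := fun t => (t - m) / |t - m|)
    (χ := fun n t => √((t - m) ^ 2 +
      (1 / ((n : ℝ) + 1)) ^ 2) - √((0 - m) ^ 2 + (1 / ((n : ℝ) + 1)) ^ 2))
    (fun n => (hsm n).sub contDiff_const) (fun n => sub_self _) (fun n t => ?_) (fun t => ?_)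
    (fun t => ?_)
  · rw [(hderiv n t).deriv, abs_div, abs_of_pos (Real.sqrt_pos.2 (hpos n t)),
      div_le_one (Real.sqrt_pos.2 (hpos n t))]
    exact Real.abs_le_sqrt (le_add_of_nonneg_right (by positivity))
  · simpa using (hlim t).sub (hlim 0)
  · simp_rw [fun n => (hderiv n t).deriv]
    rcases eq_or_ne (t - m) 0 with h0 | h0
    · simp [h0]
    · exact tendsto_const_nhds.div (hlim t) (abs_ne_zero.2 h0)

/-- The gradient vanishes almost everywhere on the zero set. -/
theorem grad_ae_eq_zero (hU : IsOpen U) (hq : 1 ≤ q) (hq' : q ≠ ⊤) (h : IsSobolevZero q U u G) :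
    ∀ᵐ x ∂volume.restrict U, u x = 0 → G x = 0 := by
  classical
  -- With `k = n + 1`, the functions `arctan (k t) / k` tend to `0` while their derivatives, bounded
  -- by `1`, tend to the indicator of `{0}`. In the limit the zero function has gradient `1_{u = 0}
  -- G`, which uniqueness makes zero.
  have hderiv : ∀ (n : ℕ) (t : ℝ), HasDerivAt
      (fun t : ℝ => (1 / ((n : ℝ) + 1)) * Real.arctan (((n : ℝ) + 1) * t))
      (1 / (1 + (((n : ℝ) + 1) * t) ^ 2)) t := by
    intro n t
    have h1 : HasDerivAt (fun t : ℝ => ((n : ℝ) + 1) * t) ((n : ℝ) + 1) t := by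
      simpa using (hasDerivAt_id t).const_mul ((n : ℝ) + 1)
    have h2 := h1.arctan.const_mul (1 / ((n : ℝ) + 1))
    have : (n : ℝ) + 1 ≠ 0 := by positivity
    rw [mul_left_comm, one_div_mul_cancel this, mul_one] at h2
    exact h2
  have key := h.comp_of_tendsto hq hq' (g := fun _ => 0) (d := fun t => if t = 0 then 1 else 0)
    (χ := fun n t => (1 / ((n : ℝ) + 1)) * Real.arctan (((n : ℝ) + 1) * t))
    (fun n => contDiff_const.mul (Real.contDiff_arctan.comp (contDiff_const.mul contDiff_id)))
    (fun n => by simp) (fun n t => ?_) (fun t => ?_) (fun t => ?_)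
  · have h1 := (key.hasWeakGradient hq).ae_eq hU (hasWeakGradient_const 0)
    filter_upwards [h1] with x hx h0
    simpa [h0] using hx
  · rw [(hderiv n t).deriv, abs_of_pos (by positivity)]
    exact div_le_one_of_le₀ (by nlinarith [sq_nonneg (((n : ℝ) + 1) * t)]) (by positivity)
  · refine squeeze_zero_norm (a := fun n : ℕ => 1 / ((n : ℝ) + 1) * (Real.pi / 2)) (fun n => ?_) ?_
    · rw [norm_mul, Real.norm_of_nonneg (by positivity : 0 ≤ 1 / ((n : ℝ) + 1))]
      gcongr
      exact abs_le.2 ⟨(Real.neg_pi_div_two_lt_arctan _).le, (Real.arctan_lt_pi_div_two _).le⟩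
    · simpa using (tendsto_one_div_add_atTop_nhds_zero_nat (𝕜 := ℝ)).mul_const (Real.pi / 2)
  · simp_rw [fun n => (hderiv n t).deriv]
    rcases eq_or_ne t 0 with h0 | h0
    · simp [h0]
    · simp only [h0, if_false]
      have h1 : Tendsto (fun n : ℕ => (n : ℝ) + 1) atTop atTop :=
        tendsto_atTop_add_const_right _ _ tendsto_natCast_atTop_atTop
      have h2 : Tendsto (fun n : ℕ => 1 + (((n : ℝ) + 1) * t) ^ 2) atTop atTop := by
        refine tendsto_atTop_add_const_left _ _ ?_
        simp_rw [mul_pow]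
        exact ((tendsto_pow_atTop two_ne_zero).comp h1).atTop_mul_const (by positivity)
      simp_rw [one_div]
      exact h2.inv_tendsto_atTop

end IsSobolevZero

end

/-! ### Mollification, localisation and level sets. -/

section

open scoped Convolution

variable {N : ℕ} {U V : Set (EuclideanSpace ℝ (Fin N))} {q : ℝ≥0∞}
  {φ ψ : EuclideanSpace ℝ (Fin N) → ℝ}
  {u v : EuclideanSpace ℝ (Fin N) → ℝ}
  {G K : EuclideanSpace ℝ (Fin N) → EuclideanSpace ℝ (Fin N)}

/-- Mollifications converge in `L¹`. -/
theorem tendsto_integral_norm_mollify_sub {F : Type*} [NormedAddCommGroup F] [NormedSpace ℝ F]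
    [CompleteSpace F] {ρ : ℕ → ContDiffBump (0 : EuclideanSpace ℝ (Fin N))} {c : ℝ}
    (hρ : Tendsto (fun n => (ρ n).rOut) atTop (𝓝 0)) (hρ' : ∀ n, (ρ n).rOut ≤ c * (ρ n).rIn)
    {g : EuclideanSpace ℝ (Fin N) → F} (hg : Integrable g) :
    Tendsto (fun n => ∫ x, ‖((ρ n).normed volume ⋆[ContinuousLinearMap.lsmul ℝ ℝ, volume] g) x
      - g x‖) atTop (𝓝 0) := by
  -- A Scheffé argument: the error `a` itself has no evident dominating function, but `a ≤ b +
  -- 2‖g‖`, where `b` is the mollification error of `‖g‖`. It has integral zero, and its negative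
  -- part is at most `‖g‖`.
  let a : ℕ → EuclideanSpace ℝ (Fin N) → ℝ := fun n x =>
    ‖((ρ n).normed volume ⋆[ContinuousLinearMap.lsmul ℝ ℝ, volume] g) x - g x‖
  let b : ℕ → EuclideanSpace ℝ (Fin N) → ℝ := fun n x =>
    ((ρ n).normed volume ⋆[ContinuousLinearMap.lsmul ℝ ℝ, volume] fun y => ‖g y‖) x - ‖g x‖
  have iρ : ∀ n, Integrable ((ρ n).normed volume : EuclideanSpace ℝ (Fin N) → ℝ) := fun n =>
    (ρ n).integrable_normed
  have ia : ∀ n, Integrable (a n) := fun n => (((iρ n).integrable_convolution _ hg).sub hg).norm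
  have ib : ∀ n, Integrable (b n) := fun n =>
    ((iρ n).integrable_convolution _ hg.norm).sub hg.norm
  have ib0 : ∀ n, ∫ x, b n x = 0 := fun n => by
    simp only [b]
    rw [integral_sub ((iρ n).integrable_convolution _ hg.norm) hg.norm,
      integral_convolution _ (iρ n) hg.norm, (ρ n).integral_normed]
    simp
  have hab : ∀ n x, a n x ≤ b n x + 2 * ‖g x‖ := by
    intro n x
    have h1 : ‖((ρ n).normed volume ⋆[ContinuousLinearMap.lsmul ℝ ℝ, volume] g) x‖ ≤
        ((ρ n).normed volume ⋆[ContinuousLinearMap.lsmul ℝ ℝ, volume] fun y => ‖g y‖) x := by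
      refine (norm_integral_le_integral_norm _).trans (le_of_eq ?_)
      refine integral_congr_ae (Eventually.of_forall fun t => ?_)
      simp [norm_smul, abs_of_nonneg ((ρ n).nonneg_normed t)]
    have := norm_sub_le (((ρ n).normed volume ⋆[ContinuousLinearMap.lsmul ℝ ℝ, volume] g) x) (g x)
    simp only [a, b]
    linarith
  have hbneg : ∀ n x, -‖g x‖ ≤ b n x := fun n x => by
    have : 0 ≤ ((ρ n).normed volume ⋆[ContinuousLinearMap.lsmul ℝ ℝ, volume] fun y => ‖g y‖) x :=
      integral_nonneg fun t => mul_nonneg ((ρ n).nonneg_normed t) (norm_nonneg _)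
    simp only [b]
    linarith
  have la : ∀ᵐ x, Tendsto (fun n => a n x) atTop (𝓝 0) := by
    filter_upwards [ContDiffBump.ae_convolution_tendsto_right_of_locallyIntegrable hρ
      (Eventually.of_forall hρ') hg.locallyIntegrable] with x hx
    simpa using (hx.sub_const (g x)).norm
  have lb : ∀ᵐ x, Tendsto (fun n => b n x) atTop (𝓝 0) := by
    filter_upwards [ContDiffBump.ae_convolution_tendsto_right_of_locallyIntegrable hρ
      (Eventually.of_forall hρ') hg.norm.locallyIntegrable] with x hx
    simpa using hx.sub_const ‖g x‖
  have iq : ∀ n, Integrable fun x => max (-b n x) 0 := fun n => (ib n).neg.pos_part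
  have ir : ∀ n, Integrable fun x => min (a n x) (2 * ‖g x‖) := fun n =>
    (ia n).inf (hg.norm.const_mul 2)
  have l1 : Tendsto (fun n => ∫ x, max (-b n x) 0) atTop
      (𝓝 (∫ _ : EuclideanSpace ℝ (Fin N), (0 : ℝ))) := by
    refine tendsto_integral_of_dominated_convergence (fun x => ‖g x‖)
      (fun n => (iq n).1) hg.norm
      (fun n => Eventually.of_forall fun x => ?_) ?_
    · rw [Real.norm_of_nonneg (le_max_right _ _)]
      exact max_le (by linarith [hbneg n x]) (norm_nonneg _)
    · filter_upwards [lb] with x hx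
      simpa using hx.neg.max (tendsto_const_nhds (x := (0 : ℝ)))
  have l2 : Tendsto (fun n => ∫ x, min (a n x) (2 * ‖g x‖)) atTop
      (𝓝 (∫ _ : EuclideanSpace ℝ (Fin N), (0 : ℝ))) := by
    refine tendsto_integral_of_dominated_convergence (fun x => 2 * ‖g x‖)
      (fun n => (ir n).1) (hg.norm.const_mul 2)
      (fun n => Eventually.of_forall fun x => ?_) ?_
    · rw [Real.norm_of_nonneg (le_min (norm_nonneg _) (by positivity))]
      exact min_le_right _ _
    · filter_upwards [la] with x hx
      have := hx.min (tendsto_const_nhds (x := 2 * ‖g x‖))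
      rwa [min_eq_left (by positivity : 0 ≤ 2 * ‖g x‖)] at this
  have l3 := l1.add l2
  simp only [integral_zero, add_zero] at l3
  refine squeeze_zero (fun n => integral_nonneg fun x => norm_nonneg _) (fun n => ?_) l3
  -- The first term integrates to zero; the other two are dominated by multiples of `‖g‖` and tend
  -- to zero almost everywhere.
  calc ∫ x, a n x ≤ ∫ x, (b n x + (max (-b n x) 0 + min (a n x) (2 * ‖g x‖))) := by
        refine integral_mono (ia n) ((ib n).add ((iq n).add (ir n))) fun x => ?_
        have h1 := hab n x
        have h2 := le_max_left (-b n x) 0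
        have h3 := le_max_right (-b n x) 0
        simp only
        rcases min_cases (a n x) (2 * ‖g x‖) with h | h <;> linarith
    _ = _ := by
      have h1 := integral_add (ib n) ((iq n).add (ir n))
      simp only [Pi.add_apply] at h1
      rw [h1, ib0, zero_add, integral_add (iq n) (ir n)]

/-- A compactly supported function with integrable weak gradient on the whole space is a limit of
test functions. -/
theorem HasWeakGradient.isSobolevZero_one (hu : Integrable u) (hG : Integrable G)
    (hc : HasCompactSupport u) (h : HasWeakGradient univ u G) : IsSobolevZero 1 univ u G := by
  -- The ratio of outer to inner radius stays equal to `2`; a bounded ratio is what almost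
  -- everywhere convergence of the mollifications requires.
  let ρ : ℕ → ContDiffBump (0 : EuclideanSpace ℝ (Fin N)) := fun n =>
    ⟨1 / ((n : ℝ) + 1), 2 / ((n : ℝ) + 1), by positivity, by gcongr; norm_num⟩
  have hρ : Tendsto (fun n => (ρ n).rOut) atTop (𝓝 0) := by
    have := (tendsto_one_div_add_atTop_nhds_zero_nat (𝕜 := ℝ)).const_mul 2
    simpa [ρ, div_eq_mul_inv] using this
  have hρ' : ∀ n, (ρ n).rOut ≤ 2 * (ρ n).rIn := fun n => by simp [ρ, div_eq_mul_inv]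
  have hcρ : ∀ n, HasCompactSupport ((ρ n).normed (volume : Measure (EuclideanSpace ℝ (Fin N)))) :=
    fun n => (ρ n).hasCompactSupport_normed
  have hsρ : ∀ n, ContDiff ℝ ∞ ((ρ n).normed (volume : Measure (EuclideanSpace ℝ (Fin N)))) :=
    fun n => (ρ n).contDiff_normed
  let w : ℕ → EuclideanSpace ℝ (Fin N) → ℝ := fun n =>
    ((ρ n).normed volume ⋆[ContinuousLinearMap.lsmul ℝ ℝ, volume] u)
  have hw : ∀ n, IsTestFunction univ (w n) := fun n =>
    ⟨(hcρ n).contDiff_convolution_left _ (hsρ n) hu.locallyIntegrable,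
      (hcρ n).convolution _ hc, subset_univ _⟩
  have hgw : ∀ n x, gradient (w n) x =
      ((ρ n).normed volume ⋆[ContinuousLinearMap.lsmul ℝ ℝ, volume] G) x := by
    intro n x
    have hT : ∀ x, IsTestFunction univ fun y => (ρ n).normed volume (x - y) := fun x =>
      ⟨(hsρ n).comp (contDiff_const.sub contDiff_id),
        (hcρ n).comp_homeomorph (Homeomorph.subLeft x), subset_univ _⟩
    have hTg : ∀ y, gradient (fun y => (ρ n).normed volume (x - y)) y =
        - gradient ((ρ n).normed volume) (x - y) := by
      intro y
      refine HasGradientAt.gradient ?_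
      have h1 := (hsρ n).hasGradientAt_gradient (x - y)
      rw [hasGradientAt_iff_hasFDerivAt] at *
      have h2 := h1.comp y ((hasFDerivAt_id y).const_sub x)
      rw [ContinuousLinearMap.comp_neg, ContinuousLinearMap.comp_id, ← map_neg] at h2
      exact h2
    -- Testing with `y ↦ ρ (x - y)` turns the weak gradient identity into `∇(ρ ⋆ u) = ρ ⋆ G` at `x`.
    have h1 := h.2.2 _ (hT x)
    have h2 := (hcρ n).hasFDerivAt_convolution_left (ContinuousLinearMap.lsmul ℝ ℝ)
      ((hsρ n).of_le (by simp)) hu.locallyIntegrable x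
    have h3 := (((hcρ n).fderiv ℝ).convolutionExists_left
      (ContinuousLinearMap.precompL (EuclideanSpace ℝ (Fin N)) (ContinuousLinearMap.lsmul ℝ ℝ))
      ((hsρ n).continuous_fderiv (by simp)) hu.locallyIntegrable x).integrable_swap
    rw [Measure.restrict_univ] at h1
    rw [convolution_lsmul_swap, ← neg_eq_iff_eq_neg.2 h1]
    refine ext_inner_left ℝ fun v => ?_
    rw [inner_gradient_right, h2.fderiv, convolution_eq_swap,
      ContinuousLinearMap.integral_apply h3, inner_neg_right,
      ← integral_inner ((hT x).integrable_smul_gradient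
        (hu.locallyIntegrable.locallyIntegrableOn univ)), ← integral_neg]
    simp only [hTg, inner_smul_right, inner_neg_right, inner_gradient_right]
    simp [ContinuousLinearMap.precompL_apply, mul_comm]
  have conv : ∀ {F : Type} [NormedAddCommGroup F] [NormedSpace ℝ F] [CompleteSpace F]
      {g : EuclideanSpace ℝ (Fin N) → F}, Integrable g → Tendsto (fun n => eLpNorm (fun x => g x -
      ((ρ n).normed volume ⋆[ContinuousLinearMap.lsmul ℝ ℝ, volume] g) x) 1
        (volume.restrict univ)) atTop (𝓝 0) := by
    intro F _ _ _ g hg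
    have h1 := ENNReal.tendsto_ofReal (tendsto_integral_norm_mollify_sub hρ hρ' hg)
    rw [ENNReal.ofReal_zero] at h1
    refine h1.congr fun n => ?_
    have h2 := ofReal_integral_norm_eq_lintegral_enorm
      ((((ρ n).integrable_normed (μ := volume)).integrable_convolution
        (ContinuousLinearMap.lsmul ℝ ℝ) hg).sub hg)
    simp only [Pi.sub_apply] at h2
    rw [h2, eLpNorm_one_eq_lintegral_enorm, Measure.restrict_univ]
    exact lintegral_congr fun x => enorm_sub_rev _ _
  refine .of_seq (φ := w) ?_ ?_ hw (conv hu) ?_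
  · simpa using memLp_one_iff_integrable.2 hu
  · simpa using memLp_one_iff_integrable.2 hG
  · simp_rw [hgw]
    exact conv hG

/-- Testing the identity for `u` with `ψ φ` gives the product rule. A cutoff makes `u` compactly
supported on the whole space, where mollification applies; the exponent is `1` because only local
integrability is available. -/
theorem HasWeakGradient.cutoff (h : HasWeakGradient U u G) (hφ : IsTestFunction U φ) :
    IsSobolevZero 1 univ (fun x => φ x * u x) (fun x => u x • gradient φ x + φ x • G x) := by
  have i1 := hφ.integrable_smul h.1
  have i2 := (hφ.integrable_smul_gradient h.1).add (hφ.integrable_smul h.2.1)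
  refine HasWeakGradient.isSobolevZero_one i1 i2 hφ.2.1.mul_right
    ⟨i1.locallyIntegrable.locallyIntegrableOn _, i2.locallyIntegrable.locallyIntegrableOn _,
      fun ψ hψ => ?_⟩
  have hm : IsTestFunction U fun x => ψ x * φ x := hφ.mul_left hψ.1
  have hg : ∀ x, gradient (fun x => ψ x * φ x) x = ψ x • gradient φ x + φ x • gradient ψ x :=
    fun x => (HasGradientAt.mul_real (hψ.1.hasGradientAt_gradient x)
      (hφ.1.hasGradientAt_gradient x)).gradient
  have h1 := h.2.2 _ hm
  rw [setIntegral_eq_integral_of_forall_compl_eq_zero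
    fun x hx => by rw [hm.gradient_eq_zero hx, smul_zero],
    setIntegral_eq_integral_of_forall_compl_eq_zero
    fun x hx => by rw [hm.apply_eq_zero hx, zero_smul]] at h1
  have i3 : Integrable fun x => ψ x • u x • gradient φ x :=
    hψ.integrable_smul ((hφ.integrable_smul_gradient h.1).locallyIntegrable.locallyIntegrableOn _)
  have i4 : Integrable fun x => (φ x * u x) • gradient ψ x :=
    hψ.integrable_smul_gradient (i1.locallyIntegrable.locallyIntegrableOn _)
  have i5 : Integrable fun x => ψ x • φ x • G x :=
    hψ.integrable_smul ((hφ.integrable_smul h.2.1).locallyIntegrable.locallyIntegrableOn _)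
  have e1 : ∫ x, u x • gradient (fun x => ψ x * φ x) x =
      (∫ x, ψ x • u x • gradient φ x) + ∫ x, (φ x * u x) • gradient ψ x := by
    rw [← integral_add i3 i4]
    refine integral_congr_ae (Eventually.of_forall fun x => ?_)
    simp only [hg]
    module
  rw [e1] at h1
  simp only [Measure.restrict_univ, smul_add]
  rw [integral_add i3 i5, neg_add]
  rw [← eq_sub_iff_add_eq'] at h1
  rw [h1]
  simp only [mul_smul]
  abel

/-- A weak gradient vanishes almost everywhere on each level set. -/
theorem HasWeakGradient.ae_eq_zero_of_eq (hU : IsOpen U) (h : HasWeakGradient U u G) (c : ℝ) :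
    ∀ᵐ x ∂volume.restrict U, u x = c → G x = 0 := by
  have h0 : HasWeakGradient U (fun x => u x - c) G := by
    simpa using h.sub (hasWeakGradient_const c)
  rw [ae_restrict_iff' hU.measurableSet]
  have hnull : volume {x | x ∈ U ∧ u x = c ∧ G x ≠ 0} = 0 := by
    refine measure_null_of_locally_null _ fun x hx => ?_
    -- Where `u = c`, the function `φ (u - c)` vanishes and its gradient reduces to `φ G`. As `φ ≠
    -- 0` near `x`, the result on zero sets applies to `G` there.
    obtain ⟨φ, hs, hc, hφ, -, h1⟩ := exists_contDiff_tsupport_subset (n := ⊤) (hU.mem_nhds hx.1)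
    refine ⟨{x | φ x ≠ 0} ∩ {x | x ∈ U ∧ u x = c ∧ G x ≠ 0}, inter_mem (mem_nhdsWithin_of_mem_nhds
      (hφ.continuous.isOpen_preimage _ isOpen_ne |>.mem_nhds (by simp [h1]))) self_mem_nhdsWithin, ?_⟩
    · have h2 := (h0.cutoff ⟨hφ, hc, hs⟩).grad_ae_eq_zero isOpen_univ le_rfl ENNReal.one_ne_top
      rw [Measure.restrict_univ] at h2
      refine measure_mono_null (fun y hy => ?_) h2
      simp only [mem_compl_iff, mem_ofPred_eq, not_forall]
      refine ⟨by simp [hy.2.2.1], ?_⟩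
      simpa [hy.2.2.1] using ⟨hy.1, hy.2.2.2⟩
  refine measure_mono_null (fun x hx => ?_) hnull
  have h1 : x ∈ U ∧ u x = c ∧ G x ≠ 0 := by simpa using hx
  exact h1

end

/-! ### Restriction, truncation and functions with zero gradient. -/

section

variable {N : ℕ} {U V : Set (EuclideanSpace ℝ (Fin N))} {q : ℝ≥0∞}
  {u v : EuclideanSpace ℝ (Fin N) → ℝ}
  {G K : EuclideanSpace ℝ (Fin N) → EuclideanSpace ℝ (Fin N)}

theorem HasWeakGradient.mono (hUV : U ⊆ V) (h : HasWeakGradient V u G) :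
    HasWeakGradient U u G := by
  refine ⟨h.1.mono_set hUV, h.2.1.mono_set hUV, fun ψ hψ => ?_⟩
  have h1 := h.2.2 ψ (hψ.mono hUV)
  rw [setIntegral_eq_integral_of_forall_compl_eq_zero fun x hx => ?_,
    setIntegral_eq_integral_of_forall_compl_eq_zero fun x hx => ?_] at h1 ⊢
  · exact h1
  all_goals first
    | rw [(hψ.mono hUV).apply_eq_zero hx, zero_smul]
    | rw [(hψ.mono hUV).gradient_eq_zero hx, smul_zero]
    | rw [hψ.apply_eq_zero hx, zero_smul]
    | rw [hψ.gradient_eq_zero hx, smul_zero]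

namespace IsSobolevZero

/-- Truncation from above. -/
theorem min_const (hU : IsOpen U) (hq : 1 ≤ q) (hq' : q ≠ ⊤) (h : IsSobolevZero q U u G) {m : ℝ}
    (hm : 0 ≤ m) :
    IsSobolevZero q U (fun x => min (u x) m) (fun x => if u x < m then G x else 0) := by
  -- For `m ≥ 0`, `min u m = (u - (|u - m| - |m|)) / 2`. On `{u = m}`, where the formula gives `G /
  -- 2`, the gradient `G` vanishes almost everywhere.
  refine ((h.sub hq (h.abs_sub hq hq' m)).const_smul (1 / 2)).congr
    (Eventually.of_forall fun x => ?_) ?_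
  · simp only [abs_of_nonneg hm]
    rcases le_total (u x) m with h1 | h1
    · rw [min_eq_left h1, abs_of_nonpos (by linarith)]
      ring
    · rw [min_eq_right h1, abs_of_nonneg (by linarith)]
      ring
  · filter_upwards [(h.hasWeakGradient hq).ae_eq_zero_of_eq hU m] with x hx
    rcases lt_trichotomy (u x) m with h1 | h1 | h1
    · rw [if_pos h1, abs_of_neg (by linarith), div_neg, div_self (by linarith)]
      module
    · simp [hx h1]
    · rw [if_neg h1.not_gt, abs_of_pos (by linarith), div_self (by linarith)]
      module

/-- A function of the closure of the test functions whose gradient vanishes is zero. -/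
theorem ae_eq_zero (hN : 1 ≤ N) (hU : IsOpen U) (hfin : volume U < ⊤) (hq : 1 ≤ q)
    (h : IsSobolevZero q U u G) (hG : G =ᵐ[volume.restrict U] 0) :
    u =ᵐ[volume.restrict U] 0 := by
  have : IsFiniteMeasure (volume.restrict U) := ⟨by simpa using hfin⟩
  have h1 := (h.congr (ae_eq_refl u) hG).indicator hU.measurableSet (subset_univ U)
  have h2 := h1.hasWeakGradient hq
  simp only [Pi.zero_def, indicator_zero] at h2
  have h3 : Integrable (U.indicator u) :=
    (integrable_indicator_iff hU.measurableSet).2 (h.memLp.integrable hq)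
  have h4 := HasWeakGradient.ae_eq_zero hN h3 h2
  rw [EventuallyEq, ae_restrict_iff' hU.measurableSet]
  filter_upwards [h4] with x hx hxU
  simpa [hxU] using hx

end IsSobolevZero

/-! ### Extended-valued integrals and integrability of the reaction term. -/

theorem extIntegral_congr {g g' : EuclideanSpace ℝ (Fin N) → ℝ}
    (h : g =ᵐ[volume.restrict U] g') : extIntegral U g = extIntegral U g' := by
  unfold extIntegral
  congr 2
  · exact lintegral_congr_ae (by filter_upwards [h] with x hx; rw [hx])
  · exact lintegral_congr_ae (by filter_upwards [h] with x hx; rw [hx])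

theorem extIntegral_eq_integral {g : EuclideanSpace ℝ (Fin N) → ℝ}
    (h : Integrable g (volume.restrict U)) : extIntegral U g = ((∫ x in U, g x : ℝ) : EReal) := by
  have h1 : ∫⁻ x in U, ENNReal.ofReal (g x) ≠ ⊤ := h.lintegral_lt_top.ne
  have h2 : ∫⁻ x in U, ENNReal.ofReal (-g x) ≠ ⊤ := h.neg.lintegral_lt_top.ne
  rw [extIntegral, integral_eq_lintegral_pos_part_sub_lintegral_neg_part h, EReal.coe_sub,
    EReal.coe_ennreal_toReal h1, EReal.coe_ennreal_toReal h2]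

/-- Once the negative part is finite, the only obstruction to integrability is the value `⊤`. -/
theorem integrable_of_extIntegral_ne_top {g : EuclideanSpace ℝ (Fin N) → ℝ}
    (hg : AEStronglyMeasurable g (volume.restrict U))
    (hneg : ∫⁻ x in U, ENNReal.ofReal (-g x) ≠ ⊤) (h : extIntegral U g ≠ ⊤) :
    Integrable g (volume.restrict U) := by
  have hpos : ∫⁻ x in U, ENNReal.ofReal (g x) ≠ ⊤ := by
    intro htop
    refine h ?_
    rw [extIntegral, htop, EReal.coe_ennreal_top, EReal.top_sub]
    simpa using hneg
  have key : ∀ {k : EuclideanSpace ℝ (Fin N) → ℝ}, AEStronglyMeasurable k (volume.restrict U) →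
      ∫⁻ x in U, ENNReal.ofReal (k x) ≠ ⊤ →
      Integrable (fun x => max (k x) 0) (volume.restrict U) := by
    intro k hk hk'
    refine (lintegral_ofReal_ne_top_iff_integrable (hk.sup (aestronglyMeasurable_const (b := (0 : ℝ))))
      (Eventually.of_forall fun x => le_max_right _ _)).1 ?_
    simpa [ENNReal.ofReal_max] using hk'
  refine ((key hg hpos).sub (key hg.neg hneg)).congr (Eventually.of_forall fun x => ?_)
  simp only [Pi.sub_apply, Pi.neg_apply]
  rcases le_total (g x) 0 with h1 | h1
  · rw [max_eq_right h1, max_eq_left (by linarith)]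
    ring
  · rw [max_eq_left h1, max_eq_right (by linarith)]
    ring

/-- Young's inequality in the form that bounds the reaction term. -/
theorem exists_integrable_bound {p : ℝ} (hp : 1 < p) [IsFiniteMeasure (volume.restrict U)]
    {f : ℝ → ℝ} (hfgrowth : ∃ C : ℝ, ∀ t, 0 ≤ t → f t ≤ C * (t ^ (p - 1) + 1))
    (hu : MemLp u (ENNReal.ofReal p) (volume.restrict U))
    (hv : MemLp v (ENNReal.ofReal p) (volume.restrict U))
    (hu0 : ∀ᵐ x ∂volume.restrict U, 0 ≤ u x) (hv0 : ∀ᵐ x ∂volume.restrict U, 0 ≤ v x) :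
    ∃ g, Integrable g (volume.restrict U) ∧ ∀ᵐ x ∂volume.restrict U, f (u x) * v x ≤ g x := by
  obtain ⟨C, hC⟩ := hfgrowth
  have hq0 : ENNReal.ofReal p ≠ 0 := by simpa using zero_lt_one.trans hp
  have i1 := hu.integrable_norm_rpow hq0 ENNReal.ofReal_ne_top
  have i2 := hv.integrable_norm_rpow hq0 ENNReal.ofReal_ne_top
  have i3 : Integrable v (volume.restrict U) :=
    hv.integrable (ENNReal.one_le_ofReal.2 hp.le)
  rw [ENNReal.toReal_ofReal (zero_lt_one.trans hp).le] at i1 i2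
  refine ⟨fun x => |C| * (‖u x‖ ^ p + ‖v x‖ ^ p + v x), ((i1.add i2).add i3).const_mul |C|, ?_⟩
  filter_upwards [hu0, hv0] with x h1 h2
  -- Replace the smaller of `u x` and `v x` by the larger.
  have h3 : u x ^ (p - 1) * v x ≤ u x ^ p + v x ^ p := by
    have hs : ∀ t : ℝ, 0 ≤ t → t ^ (p - 1) * t = t ^ p := fun t ht => by
      rw [← Real.rpow_add_one' ht (by linarith), sub_add_cancel]
    have h4 := Real.rpow_nonneg h1 p
    have h5 := Real.rpow_nonneg h2 p
    rcases le_total (u x) (v x) with h | h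
    · have : u x ^ (p - 1) * v x ≤ v x ^ (p - 1) * v x := by
        gcongr
      rw [hs _ h2] at this
      linarith
    · have : u x ^ (p - 1) * v x ≤ u x ^ (p - 1) * u x := by gcongr
      rw [hs _ h1] at this
      linarith
  rw [Real.norm_of_nonneg h1, Real.norm_of_nonneg h2]
  calc f (u x) * v x ≤ |C| * (u x ^ (p - 1) + 1) * v x := by
        gcongr
        refine (hC _ h1).trans ?_
        gcongr
        exact le_abs_self C
    _ = |C| * (u x ^ (p - 1) * v x + v x) := by ring
    _ ≤ _ := by gcongr

end

/-! ### Critical points: finite energy and the threshold bound. -/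

section

variable {N : ℕ} {Ω : Set (EuclideanSpace ℝ (Fin N))} {p : ℝ}
  {u v : EuclideanSpace ℝ (Fin N) → ℝ}
  {G K : EuclideanSpace ℝ (Fin N) → EuclideanSpace ℝ (Fin N)}
  {H : EuclideanSpace ℝ (Fin N) → ℝ} {f : ℝ → ℝ}

/-- The competitor `0` gives `J_u(u) ≤ 0`. The growth bound controls `f(u) u` from above only, which
suffices for the negative part of the integrand. So the whole integrand is integrable, then its `H`
part, and `f(u) u` follows as a difference, with no lower bound on `f`. -/
theorem IsNonnegEnergyCriticalPoint.integrable (hp : 1 < p) (hΩ : IsOpen Ω)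
    (hΩfin : volume Ω < ⊤) (hH : Continuous H) (hH0 : H 0 = 0) (hHnn : ∀ z, 0 ≤ H z)
    (hf : Continuous f) (hfgrowth : ∃ C : ℝ, ∀ t, 0 ≤ t → f t ≤ C * (t ^ (p - 1) + 1))
    (hu : IsNonnegEnergyCriticalPoint p H f Ω u) :
    Integrable (fun x => H (weakGradient Ω u x)) (volume.restrict Ω) ∧
      Integrable (fun x => f (u x) * u x) (volume.restrict Ω) := by
  have : IsFiniteMeasure (volume.restrict Ω) := ⟨by simpa using hΩfin⟩
  have hs := hu.1.isSobolevZero hΩ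
  obtain ⟨g, hg, hfg⟩ := exists_integrable_bound hp hfgrowth hs.memLp hs.memLp hu.2.1 hu.2.1
  have hmH : AEStronglyMeasurable (fun x => H (weakGradient Ω u x)) (volume.restrict Ω) :=
    hH.comp_aestronglyMeasurable hs.memLp_grad.1
  have hmf : AEStronglyMeasurable (fun x => f (u x) * u x) (volume.restrict Ω) :=
    (hf.comp_aestronglyMeasurable hs.memLp.1).mul hs.memLp.1
  have hzero : IsSobolevZero (ENNReal.ofReal p) Ω (fun _ => (0 : ℝ)) fun _ => 0 := by
    simpa using hs.const_smul 0
  have h0 : semilinearized p H f Ω u (fun _ => 0) = 0 := by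
    have h1 : (fun x => 1 / p * H (weakGradient Ω (fun _ => 0) x) - f (u x) * 0)
        =ᵐ[volume.restrict Ω] fun _ => 0 := by
      filter_upwards [hzero.weakGradient_ae_eq hp.le hΩ] with x hx
      simp [hx, hH0]
    rw [semilinearized, extIntegral_congr h1]
    simp [extIntegral]
  have hle := hu.2.2 _ (hzero.memW1pZero hp.le hΩ) (Eventually.of_forall fun _ => le_rfl)
  rw [h0] at hle
  have hi : Integrable (fun x => 1 / p * H (weakGradient Ω u x) - f (u x) * u x)
      (volume.restrict Ω) := by
    refine integrable_of_extIntegral_ne_top ((hmH.const_mul _).sub hmf) ?_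
      (hle.trans_lt EReal.zero_lt_top).ne
    refine (lt_of_le_of_lt (lintegral_mono_ae ?_) hg.lintegral_lt_top).ne
    filter_upwards [hfg] with x hx
    have h2 : 0 ≤ 1 / p * H (weakGradient Ω u x) := mul_nonneg (by positivity) (hHnn _)
    exact ENNReal.ofReal_le_ofReal (by linarith)
  have hi' : Integrable (fun x => 1 / p * H (weakGradient Ω u x)) (volume.restrict Ω) := by
    refine (hi.add hg).mono' (hmH.const_mul _) ?_
    filter_upwards [hfg] with x hx
    rw [Real.norm_of_nonneg (mul_nonneg (by positivity) (hHnn _))]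
    simp only [Pi.add_apply]
    linarith
  refine ⟨?_, (hi'.sub hi).congr (Eventually.of_forall fun x => by simp)⟩
  have := hi'.const_mul p
  refine this.congr (Eventually.of_forall fun x => ?_)
  have : p ≠ 0 := by positivity
  simp only
  field_simp

/-- Minimality in terms of real integrals, for a competitor whose gradient is known explicitly as
`K`. -/
theorem IsNonnegEnergyCriticalPoint.integral_le (hp : 1 < p) (hΩ : IsOpen Ω)
    (hu : IsNonnegEnergyCriticalPoint p H f Ω u)
    (hi : Integrable (fun x => 1 / p * H (weakGradient Ω u x) - f (u x) * u x)
      (volume.restrict Ω))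
    (hv : IsSobolevZero (ENNReal.ofReal p) Ω v K) (hv0 : ∀ᵐ x ∂volume.restrict Ω, 0 ≤ v x)
    (hi' : Integrable (fun x => 1 / p * H (K x) - f (u x) * v x) (volume.restrict Ω)) :
    ∫ x in Ω, (1 / p * H (weakGradient Ω u x) - f (u x) * u x) ≤
      ∫ x in Ω, (1 / p * H (K x) - f (u x) * v x) := by
  have hle := hu.2.2 v (hv.memW1pZero hp.le hΩ) hv0
  have h1 : (fun x => 1 / p * H (weakGradient Ω v x) - f (u x) * v x)
      =ᵐ[volume.restrict Ω] fun x => 1 / p * H (K x) - f (u x) * v x := by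
    filter_upwards [hv.weakGradient_ae_eq hp.le hΩ] with x hx
    rw [hx]
  rw [semilinearized, semilinearized, extIntegral_congr h1, extIntegral_eq_integral hi,
    extIntegral_eq_integral hi'] at hle
  exact_mod_cast hle

/-- Critical points do not exceed the threshold above which the reaction is non-positive. -/
theorem IsNonnegEnergyCriticalPoint.le_threshold (hN : 1 ≤ N) (hp : 1 < p) (hΩ : IsOpen Ω)
    (hΩfin : volume Ω < ⊤) (hH : Continuous H) (hH0 : H 0 = 0) (hHnn : ∀ z, 0 ≤ H z)
    (hHz : ∀ z, H z = 0 → z = 0) (hf : Continuous f)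
    (hfgrowth : ∃ C : ℝ, ∀ t, 0 ≤ t → f t ≤ C * (t ^ (p - 1) + 1))
    (hu : IsNonnegEnergyCriticalPoint p H f Ω u) {m : ℝ} (hm : 0 ≤ m)
    (hfm : ∀ t, m ≤ t → f t ≤ 0) : ∀ᵐ x ∂volume.restrict Ω, u x ≤ m := by
  obtain ⟨i1, i2⟩ := hu.integrable hp hΩ hΩfin hH hH0 hHnn hf hfgrowth
  have hq : 1 ≤ ENNReal.ofReal p := ENNReal.one_le_ofReal.2 hp.le
  have hs := hu.1.isSobolevZero hΩ
  have hv := hs.min_const hΩ hq ENNReal.ofReal_ne_top hm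
  set D := weakGradient Ω u
  have hi : Integrable (fun x => 1 / p * H (D x) - f (u x) * u x) (volume.restrict Ω) :=
    (i1.const_mul _).sub i2
  have i3 : Integrable (fun x => H (if u x < m then D x else 0)) (volume.restrict Ω) := by
    refine i1.mono' (hH.comp_aestronglyMeasurable hv.memLp_grad.1) (Eventually.of_forall fun x => ?_)
    rw [Real.norm_of_nonneg (hHnn _)]
    split_ifs
    · exact le_rfl
    · rw [hH0]
      exact hHnn _
  have i4 : Integrable (fun x => f (u x) * min (u x) m) (volume.restrict Ω) := by
    refine i2.mono ((hf.comp_aestronglyMeasurable hs.memLp.1).mul hv.memLp.1) ?_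
    filter_upwards [hu.2.1] with x hx
    rw [norm_mul, norm_mul]
    gcongr
    rw [Real.norm_of_nonneg hx, Real.norm_of_nonneg (le_min hx hm)]
    exact min_le_left _ _
  have hi' : Integrable (fun x => 1 / p * H (if u x < m then D x else 0) - f (u x) * min (u x) m)
      (volume.restrict Ω) := (i3.const_mul _).sub i4
  have hle := hu.integral_le hp hΩ hi hv (by filter_upwards [hu.2.1] with x hx using le_min hx hm) hi'
  -- Truncation lowers the integrand pointwise: above `m` it removes `H (Du)`, and `f(u) ≤ 0` makes
  -- the reaction term favour the smaller value. Minimality then forces equality almost everywhere,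
  -- so `H (Du) = 0` on `{u ≥ m}` and `u - min u m` has zero gradient.
  have hpt : ∀ x, 1 / p * H (if u x < m then D x else 0) - f (u x) * min (u x) m ≤
      1 / p * H (D x) - f (u x) * u x := by
    intro x
    rcases lt_or_ge (u x) m with h1 | h1
    · rw [if_pos h1, min_eq_left h1.le]
    · rw [if_neg h1.not_gt, min_eq_right h1, hH0]
      have h2 : 0 ≤ 1 / p * H (D x) := mul_nonneg (by positivity) (hHnn _)
      have h3 := mul_nonpos_of_nonpos_of_nonneg (hfm _ h1) (sub_nonneg.2 h1)
      nlinarith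
  have heq := (integral_eq_iff_of_ae_le hi' hi (Eventually.of_forall hpt)).1
    (le_antisymm (integral_mono hi' hi hpt) hle)
  have h0 := (hs.sub hq hv).ae_eq_zero hN hΩ hΩfin hq ?_
  · filter_upwards [h0] with x hx
    have : u x = min (u x) m := sub_eq_zero.1 hx
    rw [this]
    exact min_le_right _ _
  · filter_upwards [heq] with x hx
    simp only [Pi.zero_apply]
    rcases lt_or_ge (u x) m with h1 | h1
    · rw [if_pos h1, sub_self]
    · rw [if_neg h1.not_gt, sub_zero]
      rw [if_neg h1.not_gt, min_eq_right h1, hH0] at hx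
      refine hHz _ (le_antisymm ?_ (hHnn _))
      have h3 := mul_nonpos_of_nonpos_of_nonneg (hfm _ h1) (sub_nonneg.2 h1)
      have h4 : 1 / p * H (D x) ≤ 0 := by nlinarith
      exact nonpos_of_mul_nonpos_right h4 (by positivity)

/-- The reaction is non-negative below the threshold `M`, unless `M = 0`. -/
theorem nonneg_of_le_threshold {M : ℝ≥0∞} (hf : Continuous f)
    (hfpos : ∀ t, 0 < |t| → ENNReal.ofReal |t| < M → 0 < f t) (hM : M ≠ 0) {t : ℝ} (ht : 0 ≤ t)
    (htM : ENNReal.ofReal t ≤ M) : 0 ≤ f t := by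
  -- `f > 0` on `(0, b)`, hence `f ≥ 0` on `[0, b]` by continuity; this covers the endpoints `t = 0`
  -- and `t = M`. Having `b > 0` is where `M ≠ 0` enters.
  obtain ⟨b, hb, htb, hbM⟩ : ∃ b : ℝ, 0 < b ∧ t ≤ b ∧ ENNReal.ofReal b ≤ M := by
    rcases eq_or_ne M ⊤ with h | h
    · exact ⟨t + 1, by linarith, by linarith, by simp [h]⟩
    · exact ⟨M.toReal, ENNReal.toReal_pos hM h, (ENNReal.ofReal_le_iff_le_toReal h).1 htM,
        (ENNReal.ofReal_toReal h).le⟩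
  have h1 : Ioo 0 b ⊆ {s | 0 ≤ f s} := fun s hs => by
    refine (hfpos s (abs_pos.2 hs.1.ne') (lt_of_lt_of_le ?_ hbM)).le
    rw [abs_of_pos hs.1]
    exact (ENNReal.ofReal_lt_ofReal_iff hb).2 hs.2
  have h2 := closure_minimal h1 (isClosed_le continuous_const hf)
  rw [closure_Ioo hb.ne] at h2
  exact h2 ⟨ht, htb⟩

end

end Comparison

/-! ### The comparison argument. -/

theorem mainTheorem3 {N : ℕ} (hN : 1 ≤ N) {p : ℝ} (hp : 1 < p)
    {Ω : Set (EuclideanSpace ℝ (Fin N))} (hΩ : IsOpen Ω) (hΩfin : volume Ω < ⊤)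
    {H : EuclideanSpace ℝ (Fin N) → ℝ} (hHcont : Continuous H)
    (hHconv : ConvexOn ℝ Set.univ H) (hH0 : H 0 = 0)
    (hHbound : ∃ C : ℝ, 0 < C ∧ ∀ z, 1 / C * ‖z‖ ^ p ≤ H z)
    {f : ℝ → ℝ} (hfcont : Continuous f) (hfeven : ∀ t, f (-t) = f t)
    (hfgrowth : ∃ C : ℝ, ∀ t, 0 ≤ t → f t ≤ C * (t ^ (p - 1) + 1))
    {M : ℝ≥0∞} (hfpos : ∀ t, 0 < |t| → ENNReal.ofReal |t| < M → 0 < f t)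
    (hfneg : ∀ t, M ≤ ENNReal.ofReal |t| → f t ≤ 0)
    {u : EuclideanSpace ℝ (Fin N) → ℝ}
    (hu : Comparison.IsNonnegEnergyCriticalPoint p H f Ω u)
    {A : Set (EuclideanSpace ℝ (Fin N))} (hA : IsOpen A) (hAΩ : A ⊆ Ω)
    {w : EuclideanSpace ℝ (Fin N) → ℝ} (hw : Comparison.IsEnergyMinimiser p H A w)
    (hwu : Comparison.MemW1pZero p A (fun x => max (w x - u x) 0)) :
    ∀ᵐ x ∂volume.restrict A, w x ≤ u x := by
  obtain ⟨C, hC, hHC⟩ := hHbound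
  have hHnn : ∀ z, 0 ≤ H z := fun z => le_trans (by positivity) (hHC z)
  have hHz : ∀ z, H z = 0 → z = 0 := by
    intro z hz
    by_contra hne
    have h1 : 0 < 1 / C * ‖z‖ ^ p :=
      mul_pos (by positivity) (Real.rpow_pos_of_pos (norm_pos_iff.2 hne) p)
    linarith [hHC z]
  have hq : 1 ≤ ENNReal.ofReal p := ENNReal.one_le_ofReal.2 hp.le
  have hAfin : volume A < ⊤ := (measure_mono hAΩ).trans_lt hΩfin
  have : IsFiniteMeasure (volume.restrict A) := ⟨by simpa using hAfin⟩
  have hrestr : (volume.restrict Ω).restrict A = volume.restrict A := by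
    rw [Measure.restrict_restrict hA.measurableSet, inter_eq_left.2 hAΩ]
  obtain ⟨iHu, ifu⟩ := hu.integrable hp hΩ hΩfin hHcont hH0 hHnn hfcont hfgrowth
  have hs := hu.1.isSobolevZero hΩ
  have hφ := hwu.isSobolevZero hA
  have hwg := hw.1.hasWeakGradient
  have hwL := hw.1.memLp_weakGradient hA
  have hug := (hs.hasWeakGradient hq).mono hAΩ
  set φ : EuclideanSpace ℝ (Fin N) → ℝ := fun x => max (w x - u x) 0 with hφdef
  set Du := Comparison.weakGradient Ω u
  set Dw := Comparison.weakGradient A w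
  set Dφ := Comparison.weakGradient A φ
  have hφ0 : ∀ x, 0 ≤ φ x := fun x => le_max_right _ _
  have huA : MemLp u (ENNReal.ofReal p) (volume.restrict A) :=
    hs.memLp.mono_measure (Measure.restrict_mono_set _ hAΩ)
  have hDuA : MemLp Du (ENNReal.ofReal p) (volume.restrict A) :=
    hs.memLp_grad.mono_measure (Measure.restrict_mono_set _ hAΩ)
  have hu0A : ∀ᵐ x ∂volume.restrict A, 0 ≤ u x :=
    ae_restrict_of_ae_restrict_of_subset hAΩ hu.2.1
  -- the gradient of the positive part
  have hDφ : ∀ᵐ x ∂volume.restrict A, Dφ x = if 0 < φ x then Dw x - Du x else 0 := by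
    -- No chain rule for `w - u` is needed: `(w - u) - φ` vanishes where `φ > 0`, so its gradient
    -- does too, and `Dφ` vanishes where `φ = 0`.
    have h1 := ((hwg.sub hug).sub (hφ.hasWeakGradient hq)).ae_eq_zero_of_eq hA 0
    filter_upwards [h1, hφ.grad_ae_eq_zero hA hq ENNReal.ofReal_ne_top] with x h1 h2
    split_ifs with h
    · refine (sub_eq_zero.1 (h1 ?_)).symm
      have : 0 < w x - u x := by simpa [hφdef] using h
      simp [hφdef, max_eq_left this.le]
    · exact h2 (le_antisymm (not_lt.1 h) (hφ0 x))
  -- the densities of the competitors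
  have iHuA : Integrable (fun x => H (Du x)) (volume.restrict A) :=
    iHu.mono_measure (Measure.restrict_mono_set _ hAΩ)
  have iHw : Integrable (fun x => H (Dw x)) (volume.restrict A) :=
    (lintegral_ofReal_ne_top_iff_integrable (hHcont.comp_aestronglyMeasurable hwL.1)
      (Eventually.of_forall fun _ => hHnn _)).1 hw.2.1.ne
  have iHz : Integrable (fun x => H (Dw x - Dφ x)) (volume.restrict A) := by
    refine (iHw.add iHuA).mono' (hHcont.comp_aestronglyMeasurable (hwL.1.sub hφ.memLp_grad.1)) ?_
    filter_upwards [hDφ] with x hx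
    rw [Real.norm_of_nonneg (hHnn _), hx]
    split_ifs
    · simpa using hHnn (Dw x)
    · simpa using hHnn (Du x)
  have iHv : Integrable (fun x => H (Du x + Dφ x)) (volume.restrict A) := by
    refine (iHw.add iHuA).mono' (hHcont.comp_aestronglyMeasurable (hDuA.1.add hφ.memLp_grad.1)) ?_
    filter_upwards [hDφ] with x hx
    rw [Real.norm_of_nonneg (hHnn _), hx]
    split_ifs
    · simpa using hHnn (Du x)
    · simpa using hHnn (Dw x)
  -- On `{φ > 0}` both sides are `H (Dw) - H (Du)`; elsewhere both are zero.
  have hsum : ∀ᵐ x ∂volume.restrict A,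
      H (Du x + Dφ x) - H (Du x) = H (Dw x) - H (Dw x - Dφ x) := by
    filter_upwards [hDφ] with x hx
    rw [hx]
    split_ifs <;> simp
  -- minimality of `w`
  have hmin : ∫ x in A, H (Dw x) ≤ ∫ x in A, H (Dw x - Dφ x) := by
    -- The competitor `w - φ` is `min u w`.
    have hz : Comparison.MemW1pZero p A (fun x => (w x - φ x) - w x) := by
      refine Comparison.IsSobolevZero.memW1pZero (G := fun x => (-1 : ℝ) • Dφ x) hp.le hA ?_
      exact (hφ.const_smul (-1)).congr (Eventually.of_forall fun x => by simp) (ae_eq_refl _)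
    have h1 := hw.2.2 _ hz
    have hzg := hwg.sub (hφ.hasWeakGradient hq)
    have h2 : Comparison.energy H A (fun x => w x - φ x) =
        ∫⁻ x in A, ENNReal.ofReal (H (Dw x - Dφ x)) := by
      refine lintegral_congr_ae ?_
      filter_upwards [hzg.weakGradient.ae_eq hA hzg] with x hx
      rw [hx]
    rw [h2, Comparison.energy, ← ofReal_integral_eq_lintegral_ofReal iHw
      (Eventually.of_forall fun _ => hHnn _), ← ofReal_integral_eq_lintegral_ofReal iHz
      (Eventually.of_forall fun _ => hHnn _)] at h1
    exact (ENNReal.ofReal_le_ofReal_iff (integral_nonneg fun _ => hHnn _)).1 h1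
  -- bound by the threshold
  have hthr : M ≠ ⊤ → ∀ᵐ x ∂volume.restrict A, u x ≤ M.toReal := fun hM =>
    ae_restrict_of_ae_restrict_of_subset hAΩ
      (hu.le_threshold hN hp hΩ hΩfin hHcont hH0 hHnn hHz hfcont hfgrowth ENNReal.toReal_nonneg
        fun t ht => hfneg t (by
          rw [abs_of_nonneg (ENNReal.toReal_nonneg.trans ht)]
          exact (ENNReal.le_ofReal_iff_toReal_le hM (ENNReal.toReal_nonneg.trans ht)).2 ht))
  -- For `M = ⊤` the default `M.toReal = 0` merges the two alternatives.
  have hlevel : ∀ᵐ x ∂volume.restrict A, 0 < φ x → u x = 0 ∨ u x = M.toReal := by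
    rcases eq_or_ne M 0 with hM | hM
    -- For `M = 0` the value `f 0` may be negative, so the sign argument below fails; the threshold
    -- bound gives `u = 0` directly.
    · filter_upwards [hthr (by simp [hM]), hu0A] with x h1 h2 _
      rw [hM, ENNReal.toReal_zero] at h1
      exact Or.inl (le_antisymm h1 h2)
    have hle : ∀ᵐ x ∂volume.restrict A, ENNReal.ofReal (u x) ≤ M := by
      rcases eq_or_ne M ⊤ with h | h
      · simp [h]
      · filter_upwards [hthr h] with x hx
        exact (ENNReal.ofReal_le_iff_le_toReal h).2 hx
    have hfu : ∀ᵐ x ∂volume.restrict A, 0 ≤ f (u x) := by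
      filter_upwards [hle, hu0A] with x h1 h2
      exact Comparison.nonneg_of_le_threshold hfcont hfpos hM h2 h1
    have ifφ : Integrable (fun x => f (u x) * φ x) (volume.restrict A) := by
      obtain ⟨g, hg, hfg⟩ := Comparison.exists_integrable_bound hp hfgrowth huA hφ.memLp hu0A
        (Eventually.of_forall hφ0)
      refine hg.mono' ((hfcont.comp_aestronglyMeasurable huA.1).mul hφ.memLp.1) ?_
      filter_upwards [hfg, hfu] with x h1 h2
      rwa [Real.norm_of_nonneg (mul_nonneg h2 (hφ0 x))]
    -- The competitor for `u` is `max u w` in `A` and `u` elsewhere in `Ω`.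
    have hv := hs.add hq (hφ.indicator hA.measurableSet hAΩ)
    have hiu : Integrable (fun x => 1 / p * H (Du x) - f (u x) * u x) (volume.restrict Ω) :=
      (iHu.const_mul _).sub ifu
    have iHd : Integrable (fun x => 1 / p * (H (Du x + Dφ x) - H (Du x))) (volume.restrict A) :=
      (iHv.sub iHuA).const_mul _
    have hid : Integrable (fun x => 1 / p * (H (Du x + Dφ x) - H (Du x)) - f (u x) * φ x)
        (volume.restrict A) := iHd.sub ifφ
    have hidΩ : Integrable (A.indicator fun x => 1 / p * (H (Du x + Dφ x) - H (Du x)) -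
        f (u x) * φ x) (volume.restrict Ω) := by
      rwa [integrable_indicator_iff hA.measurableSet, IntegrableOn, hrestr]
    have heq : (fun x => 1 / p * H (Du x + A.indicator Dφ x) -
        f (u x) * (u x + A.indicator φ x)) = fun x => (1 / p * H (Du x) - f (u x) * u x) +
        A.indicator (fun x => 1 / p * (H (Du x + Dφ x) - H (Du x)) - f (u x) * φ x) x := by
      ext x
      by_cases hx : x ∈ A
      · simp only [indicator_of_mem hx]
        ring
      · simp [indicator_of_notMem hx]
    have hcmp : ∫ x in Ω, (1 / p * H (Du x) - f (u x) * u x) ≤ _ := hu.integral_le hp hΩ hiu hv (by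
      filter_upwards [hu.2.1] with x hx
      exact add_nonneg hx (indicator_nonneg (fun x _ => hφ0 x) x)) (by
      rw [heq]
      exact hiu.add hidΩ)
    -- After cancelling `J_u(u)`, `hsum` replaces the increment of the energy of `u` by the one
    -- controlled by `hmin`.
    rw [heq, integral_add hiu hidΩ, integral_indicator hA.measurableSet, hrestr,
      integral_sub iHd ifφ, integral_const_mul,
      integral_congr_ae hsum, integral_sub iHw iHz] at hcmp
    have h1 : 1 / p * ((∫ x in A, H (Dw x)) - ∫ x in A, H (Dw x - Dφ x)) ≤ 0 :=
      mul_nonpos_of_nonneg_of_nonpos (by positivity) (sub_nonpos.2 hmin)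
    have hnn : 0 ≤ᵐ[volume.restrict A] fun x => f (u x) * φ x := by
      filter_upwards [hfu] with x hx using mul_nonneg hx (hφ0 x)
    have h2 : ∫ x in A, f (u x) * φ x = 0 :=
      le_antisymm (by linarith) (integral_nonneg_of_ae hnn)
    filter_upwards [(integral_eq_zero_iff_of_nonneg_ae hnn ifφ).1 h2, hu0A, hle] with x h3 h4 h5 h6
    have h7 : f (u x) = 0 := (mul_eq_zero.1 h3).resolve_right h6.ne'
    by_contra! hne
    refine (hfpos (u x) (abs_pos.2 hne.1) ?_).ne' h7
    rw [abs_of_nonneg h4]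
    refine lt_of_le_of_ne h5 fun h8 => hne.2 ?_
    rw [← h8, ENNReal.toReal_ofReal h4]
  -- both gradients vanish where `w` exceeds `u`
  have hDu : ∀ᵐ x ∂volume.restrict A, 0 < φ x → Du x = 0 := by
    filter_upwards [hlevel, hug.ae_eq_zero_of_eq hA 0, hug.ae_eq_zero_of_eq hA M.toReal]
      with x h1 h2 h3 h4
    exact (h1 h4).elim h2 h3
  -- With `Du = 0` on `{φ > 0}`, the competitor `min u w` has density `H 0 = 0` there and that of
  -- `w` elsewhere. Minimality of `w` turns this pointwise inequality into an equality almost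
  -- everywhere.
  have hle : ∀ᵐ x ∂volume.restrict A, H (Dw x - Dφ x) ≤ H (Dw x) := by
    filter_upwards [hDφ, hDu] with x h1 h2
    rw [h1]
    split_ifs with h
    · rw [sub_sub_cancel, h2 h, hH0]
      exact hHnn _
    · rw [sub_zero]
  have heq := (integral_eq_iff_of_ae_le iHz iHw hle).1
    (le_antisymm (integral_mono_ae iHz iHw hle) hmin)
  have hzero := hφ.ae_eq_zero hN hA hAfin hq (by
    filter_upwards [hDφ, hDu, heq] with x h1 h2 h3
    rw [h1] at h3 ⊢
    split_ifs at h3 ⊢ with h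
    · rw [sub_sub_cancel, h2 h, hH0] at h3
      rw [h2 h, hHz _ h3.symm, sub_zero, Pi.zero_apply]
    · rfl)
  filter_upwards [hzero] with x hx
  have : w x - u x ≤ 0 := (le_max_left _ _).trans hx.le
  linarith
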